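/- Let $\mu,\nu$ be probability measures on $\mathbb R$ with finite first moments, $\mu$ without atoms, and let $\mathbb P$ be a left-monotone martingale transport plan from $\mu$ to $\nu$. That is, $\mathbb P$ is a probability measure on $\mathbb R^2$ whose coordinates $(X,Y)$ satisfy $X\sim\mu$, $Y\sim\nu$, $\mathbb E^{\mathbb P}[Y\mid X]=X$ a.s., and there is a Borel set $\Gamma\subset\mathbb R^2$ with $\mathbb P(\Gamma)=1$ such that $y'\notin(y_0,y_1)$ whenever $(x,y_0),(x,y_1),(x',y')\in\Gamma$ and $x<x'$. Say that $(S,T_d,T_u)$ represents $\mathbb P$ if $S\subset\mathbb R$ is a Borel set with $\mu(S)=1$ and $T_d,T_u:\mathbb R\to\mathbb R$ are Borel maps such that $$\mathbb P(dx,dy)=\mu(dx)\big[q(x)\,\delta_{T_u(x)}+(1-q(x))\,\delta_{T_d(x)}\big](dy),\qquad q(x)=\frac{x-T_d(x)}{T_u(x)-T_d(x)}\mathbf 1_{\{T_d(x)<T_u(x)\}},$$ and, for all $x,y\in S$: $T_d(x)\le x\le T_u(x)$; $T_d(x)=x$ if and only if $T_u(x)=x$; $T_u(x)\le T_u(y)$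 if $x\le y$; and $T_d(y)\notin(T_d(x),T_u(x))$ if $x<y$. Then $\mathbb P$ is represented by some $(S,T_d,T_u)$. Moreover, let $(S,T_d,T_u)$ be any triple that represents $\mathbb P$, and put $$R=\bigcup_{x\in S}[T_u(x)-x,\infty)\times\{T_u(x)\}\ \cup\ \bigcup_{x\in S}[T_d(x)-x,\infty)\times\{T_d(x)\}.$$ Then $R$ is a barrier, i.e. it is Borel and $(x,y)\in R$ implies $[x,\infty)\times\{y\}\subset R$. Let $(\Omega,\mathcal F,(\mathcal F_t)_{t\ge0},\mathbb Q)$ be any filtered probability space satisfying the usual conditions, and let $B$ be an $(\mathcal F_t)$-Brownian motion on it with $B_0\sim\mu$. Define $$\tau_R=\inf\{t\ge0:(B_t-B_0,B_t)\in R\},\qquad \tau^{\mathbb P}=\inf\{t>0:B_t\notin[T_d(B_0),T_u(B_0)]\}.$$ Then $\tau_R$ and $\tau^{\mathbb P}$ are stopping times and $\tau_R=\tau^{\mathbb P}$ almost surely. Furthermore $\tau_R$ is almost surely finite, $(B_0,B_{\tau_R})\sim\mathbb P$ (in particular $B_{\tau_R}\sim\nu$), and $\tau_R$ is minimal: every stopping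 time $\sigma\le\tau_R$ with $B_\sigma\sim\nu$ satisfies $\sigma=\tau_R$ almost surely. Thus the left-monotone martingale transport plan is a barrier-type solution of the Skorokhod embedding problem. -/

import Mathlib

open MeasureTheory ProbabilityTheory Set
open scoped NNReal ENNReal

noncomputable section

/-- `P` is a martingale transport plan from `μ` to `ν`: a probability measure on `ℝ × ℝ` whose
coordinates `(X, Y)` satisfy `X ∼ μ`, `Y ∼ ν` and `E[Y | X] = X` almost surely. -/
structure IsMartingalePlan (μ ν : Measure ℝ) (P : Measure (ℝ × ℝ)) : Prop where
  isProbabilityMeasure : IsProbabilityMeasure P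
  map_fst : P.map Prod.fst = μ
  map_snd : P.map Prod.snd = ν
  condExp_snd : P[(Prod.snd : ℝ × ℝ → ℝ) |
    MeasurableSpace.comap (Prod.fst : ℝ × ℝ → ℝ) inferInstance] =ᵐ[P] Prod.fst

/-- `P` is left-monotone: it is carried by a Borel set `Γ` such that for all
`(x, y₀), (x, y₁), (x', y') ∈ Γ` with `x < x'` one has `y' ∉ (y₀, y₁)`. -/
def IsLeftMonotone (P : Measure (ℝ × ℝ)) : Prop :=
  ∃ Γ : Set (ℝ × ℝ), MeasurableSet Γ ∧ P Γ = 1 ∧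
    ∀ x y₀ y₁ x' y' : ℝ, (x, y₀) ∈ Γ → (x, y₁) ∈ Γ → (x', y') ∈ Γ → x < x' → y' ∉ Ioo y₀ y₁

/-- The weight `q(x) = (x - T_d(x)) / (T_u(x) - T_d(x)) 1_{T_d(x) < T_u(x)}`. -/
def upWeight (Td Tu : ℝ → ℝ) (x : ℝ) : ℝ :=
  if Td x < Tu x then (x - Td x) / (Tu x - Td x) else 0

/-- The pair of Borel maps `(T_d, T_u)`, considered on a Borel set `S` of full `μ`-measure,
represents the left-monotone plan `P`. -/
structure IsMonotonePair (μ : Measure ℝ) (P : Measure (ℝ × ℝ)) (S : Set ℝ) (Td Tu : ℝ → ℝ) :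
    Prop where
  measurableSet : MeasurableSet S
  measure_compl : μ Sᶜ = 0
  measurable_down : Measurable Td
  measurable_up : Measurable Tu
  down_le : ∀ x ∈ S, Td x ≤ x
  le_up : ∀ x ∈ S, x ≤ Tu x
  down_eq_iff : ∀ x ∈ S, Td x = x ↔ Tu x = x
  /-- `P(dx, dy) = μ(dx) [q(x) δ_{T_u(x)} + (1 - q(x)) δ_{T_d(x)}](dy)`. -/
  plan_eq : P = μ.bind fun x ↦
    ENNReal.ofReal (upWeight Td Tu x) • Measure.dirac (x, Tu x) +
      ENNReal.ofReal (1 - upWeight Td Tu x) • Measure.dirac (x, Td x)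
  monotone_up : ∀ x ∈ S, ∀ y ∈ S, x ≤ y → Tu x ≤ Tu y
  down_notMem : ∀ x ∈ S, ∀ y ∈ S, x < y → Td y ∉ Ioo (Td x) (Tu x)

/-- A barrier: a measurable subset of `ℝ × ℝ` containing `[x, ∞) × {y}` with each of its
points `(x, y)`. -/
def IsBarrier (R : Set (ℝ × ℝ)) : Prop :=
  MeasurableSet R ∧ ∀ x y : ℝ, (x, y) ∈ R → Ici x ×ˢ {y} ⊆ R

/-- The part `⋃_{x ∈ S} [T(x) - x, ∞) × {T(x)}` of the barrier coming from one map `T`. -/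
def barrierPart (S : Set ℝ) (T : ℝ → ℝ) : Set (ℝ × ℝ) :=
  ⋃ x ∈ S, Ici (T x - x) ×ˢ {T x}

/-- The set `R = R_u ∪ R_d`. -/
def monotoneBarrier (S : Set ℝ) (Td Tu : ℝ → ℝ) : Set (ℝ × ℝ) :=
  barrierPart S Tu ∪ barrierPart S Td

/-- The hitting time `τ_R = inf {t ≥ 0 : (B_t - B_0, B_t) ∈ R}`, equal to `⊤` if there is no
such `t`. -/
def barrierTime {Ω : Type*} (B : ℝ≥0 → Ω → ℝ) (R : Set (ℝ × ℝ)) : Ω → WithTop ℝ≥0 :=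
  hittingAfter (fun t ω ↦ (B t ω - B 0 ω, B t ω)) R 0

/-- The exit time `inf {t > 0 : B_t ∉ [T_d(B_0), T_u(B_0)]}`, equal to `⊤` if there is no
such `t`. -/
def planExitTime {Ω : Type*} (B : ℝ≥0 → Ω → ℝ) (Td Tu : ℝ → ℝ) : Ω → WithTop ℝ≥0 :=
  fun ω ↦ sInf ((fun t : ℝ≥0 ↦ (t : WithTop ℝ≥0)) ''
    {t : ℝ≥0 | 0 < t ∧ B t ω ∉ Icc (Td (B 0 ω)) (Tu (B 0 ω))})

/-- The filtration `𝓕` satisfies the usual conditions: it is right-continuous and `𝓕 0` contains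
all null sets. -/
structure UsualConditions {Ω : Type*} {mΩ : MeasurableSpace Ω} (𝓕 : Filtration ℝ≥0 mΩ)
    (Q : Measure Ω) : Prop where
  rightContinuous : 𝓕.IsRightContinuous
  complete : ∀ A : Set Ω, Q A = 0 → MeasurableSet[𝓕 0] A

/-- `B` is a (one-dimensional standard) Brownian motion relative to the filtration `𝓕`, started
from `B_0 ∼ μ`. -/
structure IsBrownianFrom {Ω : Type*} {mΩ : MeasurableSpace Ω} (𝓕 : Filtration ℝ≥0 mΩ)
    (Q : Measure Ω) (μ : Measure ℝ) (B : ℝ≥0 → Ω → ℝ) : Prop where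
  adapted : Adapted 𝓕 B
  hasLaw_zero : HasLaw (B 0) μ Q
  brownian : IsBrownianReal (fun t ω ↦ B t ω - B 0 ω) Q
  indep : ∀ s t : ℝ≥0, s ≤ t →
    Indep (MeasurableSpace.comap (fun ω ↦ B t ω - B s ω) inferInstance) (𝓕 s) Q

/-- `τ` is a minimal stopping time embedding `ν`: it is an almost surely finite stopping time
with `B_τ ∼ ν`, and every stopping time `σ ≤ τ` with `B_σ ∼ ν` is almost surely equal to `τ`. -/
structure IsMinimalEmbedding {Ω : Type*} {mΩ : MeasurableSpace Ω} (𝓕 : Filtration ℝ≥0 mΩ)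
    (Q : Measure Ω) (B : ℝ≥0 → Ω → ℝ) (ν : Measure ℝ) (τ : Ω → WithTop ℝ≥0) : Prop where
  isStoppingTime : IsStoppingTime 𝓕 τ
  ae_ne_top : ∀ᵐ ω ∂Q, τ ω ≠ ⊤
  hasLaw : HasLaw (stoppedValue B τ) ν Q
  minimal : ∀ σ : Ω → WithTop ℝ≥0, IsStoppingTime 𝓕 σ → σ ≤ᵐ[Q] τ →
    HasLaw (stoppedValue B σ) ν Q → σ =ᵐ[Q] τ

end

/-! Existence. Disintegrate the plan as `μ ⊗ₘ κ`. Left-monotonicity leaves only countably many `x`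
over which `Γ` has three points (`countable_three_points`), and `μ` has no atoms, so almost every `κ
x` lives on at most two points. Its mean is `x`, which fixes the weights (`exists_twoPoint`); the
no-crossing rule of `Γ` becomes the two order conditions on `Td` and `Tu`.

Hitting time. For `x ∈ S` the points `(y - x, y)` with `Td x < y < Tu x` avoid the barrier, while
those with `y` an end point lie on it. Hence almost surely `barrierTime` is the first time
`boundaryTime` at which `B` reaches an end point of its own interval. Between that time and
`planExitTime` the path stays in the interval, so optional stopping from an end point forces `B` not
to move. Brownian motion takes different values at any two given distinct times, so the two times
agree (`ae_eq_of_forall_stoppedValue_ae_eq`).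

Law. At the boundary time `B` sits at an end point, and its conditional mean given time `0` is `B
0`; the conditional probability of the upper end is therefore `upWeight`.

Minimality. If `B` has the same law at `σ ≤ τ`, Jensen for `y ↦ (y - a)⁺` is an equality for every
`a`, so `B` has the same value at every stopping time between them, and again `σ = τ`. Without
uniform integrability of `B`, all of this is localised to events known at time `0` on which the
interval is bounded; integrability of `ν` suffices to pass to the limit. -/

/-! ### Measurability of the barrier -/

/-- A set whose elements can be separated by labels from a countable type is countable. -/
theorem Set.countable_of_forall_exists_label {α β : Type*} [Countable β] {C : Set α}
    (r : α → β → Prop) (hex : ∀ y ∈ C, ∃ q, r y q)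
    (huniq : ∀ y ∈ C, ∀ y' ∈ C, ∀ q, r y q → r y' q → y = y') : C.Countable := by
  choose q hq using hex
  have hinj : Function.Injective fun y : C ↦ q y y.2 := by
    intro y y' (h : q y y.2 = q y' y'.2)
    exact Subtype.ext (huniq y y.2 y' y'.2 _ (hq y y.2) (h ▸ hq y' y'.2))
  exact hinj.countable

/-- The values that a function takes at least twice on a set. -/
def multipleValues (S : Set ℝ) (f : ℝ → ℝ) : Set ℝ :=
  {y | ∃ x ∈ S, ∃ x' ∈ S, x < x' ∧ f x = y ∧ f x' = y}

/-- An uncountable union of half-lines needs an argument. Over the countably many repeated values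
there are countably many measurable pieces; elsewhere `(x, a) ↦ (a, f x)` is injective, and an
injective measurable image of a Borel set is Borel. -/
theorem measurableSet_barrierPart {S : Set ℝ} {f : ℝ → ℝ} (hS : MeasurableSet S)
    (hf : Measurable f) (hc : (multipleValues S f).Countable) :
    MeasurableSet (barrierPart S f) := by
  set C := multipleValues S f with hC
  have hdecomp : barrierPart S f =
      (⋃ y ∈ C, {a | ∃ x ∈ S, f x = y ∧ y - x ≤ a} ×ˢ {y}) ∪
        (fun p : ℝ × ℝ ↦ (p.2, f p.1)) ''
          {p : ℝ × ℝ | (p.1 ∈ S ∧ f p.1 ∉ C) ∧ f p.1 - p.1 ≤ p.2} := by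
    ext ⟨a, y⟩
    simp only [barrierPart, mem_iUnion, mem_prod, mem_Ici, mem_singleton_iff, mem_union, mem_image,
      mem_ofPred_eq, Prod.exists, Prod.mk.injEq, exists_prop]
    constructor
    · rintro ⟨x, hx, hxa, rfl⟩
      by_cases h : f x ∈ C
      · exact .inl ⟨f x, h, ⟨x, hx, rfl, hxa⟩, rfl⟩
      · exact .inr ⟨x, a, ⟨⟨hx, h⟩, hxa⟩, rfl, rfl⟩
    · rintro (⟨_, -, ⟨x, hx, rfl, hxa⟩, rfl⟩ | ⟨x, b, ⟨⟨hx, -⟩, hxa⟩, rfl, rfl⟩)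
      · exact ⟨x, hx, hxa, rfl⟩
      · exact ⟨x, hx, hxa, rfl⟩
  rw [hdecomp]
  refine .union (.biUnion hc fun y _ ↦ .prod (OrdConnected.measurableSet ?_)
    (measurableSet_singleton y)) (MeasurableSet.image_of_measurable_injOn ?_ ?_ ?_)
  · exact IsUpperSet.ordConnected fun a b hab ⟨x, hx, hxy, hxa⟩ ↦ ⟨x, hx, hxy, hxa.trans hab⟩
  · have h1 : MeasurableSet {p : ℝ × ℝ | p.1 ∈ S} := measurable_fst hS
    have h2 : MeasurableSet {p : ℝ × ℝ | f p.1 ∉ C} :=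
      (hf.comp measurable_fst) hc.measurableSet.compl
    have h3 : MeasurableSet {p : ℝ × ℝ | f p.1 - p.1 ≤ p.2} :=
      measurableSet_le (by fun_prop) (by fun_prop)
    exact (h1.inter h2).inter h3
  · fun_prop
  · rintro ⟨x, a⟩ ⟨⟨hx, hxC⟩, -⟩ ⟨x', a'⟩ ⟨⟨hx', -⟩, -⟩ h
    simp only [Prod.mk.injEq] at h
    obtain ⟨rfl, hxx'⟩ := h
    rcases lt_trichotomy x x' with hlt | rfl | hlt
    · exact absurd ⟨x, hx, x', hx', hlt, rfl, hxx'.symm⟩ hxC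
    · rfl
    · exact absurd ⟨x', hx', x, hx, hlt, hxx'.symm, rfl⟩ hxC

theorem barrierPart_union (S T : Set ℝ) (f : ℝ → ℝ) :
    barrierPart (S ∪ T) f = barrierPart S f ∪ barrierPart T f := by
  simp only [barrierPart, biUnion_union]

theorem countable_multipleValues_of_monotoneOn {S : Set ℝ} {f : ℝ → ℝ} (hf : MonotoneOn f S) :
    (multipleValues S f).Countable := by
  refine countable_of_forall_exists_label
    (fun y (q : ℚ) ↦ ∃ x ∈ S, ∃ x' ∈ S, x < q ∧ q < x' ∧ f x = y ∧ f x' = y) ?_ ?_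
  · rintro y ⟨x, hx, x', hx', hlt, h, h'⟩
    obtain ⟨q, hq, hq'⟩ := exists_rat_btwn hlt
    exact ⟨q, x, hx, x', hx', hq, hq', h, h'⟩
  · rintro y - z - q ⟨x, hx, x', hx', hq, hq', rfl, h⟩ ⟨w, hw, w', hw', hqw, hqw', rfl, h'⟩
    apply le_antisymm
    · rw [← h']; exact hf hx hw' (hq.trans hqw').le
    · rw [← h]; exact hf hw hx' (hqw.trans hq').le

namespace IsMonotonePair

variable {μ : Measure ℝ} {P : Measure (ℝ × ℝ)} {S : Set ℝ} {Td Tu : ℝ → ℝ}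

/-- Label a repeated value `c` by a rational between two of its preimages and a rational between `c`
and `Tu` of the smaller one. Two values `c < d` sharing a label would put a value of `Td` inside an
earlier interval `(Td x, Tu x)`. Restricting to `Td x < x` makes that interval nonempty. -/
theorem countable_multipleValues_down (h : IsMonotonePair μ P S Td Tu) :
    (multipleValues (S ∩ {x | Td x < x}) Td).Countable := by
  refine countable_of_forall_exists_label (fun c (q : ℚ × ℚ) ↦ ∃ x ∈ S, ∃ x' ∈ S,
    x < q.1 ∧ q.1 < x' ∧ Td x = c ∧ Td x' = c ∧ c < q.2 ∧ q.2 < Tu x) ?_ ?_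
  · rintro c ⟨x, ⟨hx, hxx : Td x < x⟩, x', ⟨hx', -⟩, hlt, rfl, hc⟩
    obtain ⟨q, hq, hq'⟩ := exists_rat_btwn hlt
    obtain ⟨r, hr, hr'⟩ := exists_rat_btwn (hxx.trans_le (h.le_up x hx))
    exact ⟨(q, r), x, hx, x', hx', hq, hq', rfl, hc, hr, hr'⟩
  · rintro c - d - ⟨q, r⟩ ⟨x, hx, x', hx', hq, hq', rfl, h1, hr, hr'⟩
      ⟨w, hw, w', hw', hqw, hqw', rfl, h2, hrw, hrw'⟩
    by_contra hne
    rcases lt_or_gt_of_ne hne with hlt | hlt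
    · have := h.down_notMem x hx w' hw' (hq.trans hqw')
      rw [h2] at this
      exact this ⟨hlt, hrw.trans hr'⟩
    · have := h.down_notMem w hw x' hx' (hqw.trans hq')
      rw [h1] at this
      exact this ⟨hlt, hr.trans hrw'⟩

theorem isBarrier (h : IsMonotonePair μ P S Td Tu) : IsBarrier (monotoneBarrier S Td Tu) := by
  constructor
  · refine .union (measurableSet_barrierPart h.measurableSet h.measurable_up
      (countable_multipleValues_of_monotoneOn fun x hx y hy ↦ h.monotone_up x hx y hy)) ?_
    -- `Td` itself need not be monotone, but it is the identity on the first piece, and the second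
    -- is covered by `countable_multipleValues_down`.
    have hS : S = (S ∩ {x | Td x = x}) ∪ (S ∩ {x | Td x < x}) := by
      ext x
      simp only [mem_union, mem_inter_iff, mem_ofPred_eq, ← and_or_left, iff_self_and]
      exact fun hx ↦ (h.down_le x hx).eq_or_lt
    rw [hS, barrierPart_union]
    refine .union ?_ ?_
    · refine measurableSet_barrierPart
        (h.measurableSet.inter (measurableSet_eq_fun h.measurable_down measurable_id))
        h.measurable_down (countable_multipleValues_of_monotoneOn ?_)
      rintro x ⟨-, hx : Td x = x⟩ y ⟨-, hy : Td y = y⟩ hxy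
      rwa [hx, hy]
    · exact measurableSet_barrierPart
        (h.measurableSet.inter (measurableSet_lt h.measurable_down measurable_id))
        h.measurable_down h.countable_multipleValues_down
  · rintro x y hxy ⟨a, b⟩ ⟨ha : x ≤ a, hb : b = y⟩
    subst hb
    simp only [monotoneBarrier, barrierPart, mem_union, mem_iUnion, mem_prod, mem_Ici,
      mem_singleton_iff, exists_prop] at hxy ⊢
    refine hxy.imp ?_ ?_ <;> exact fun ⟨z, hz, hzx, h⟩ ↦ ⟨z, hz, hzx.trans ha, h⟩

end IsMonotonePair

/-! ### Two-point kernels and existence of a representation -/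

theorem measurable_upWeight {Td Tu : ℝ → ℝ} (hd : Measurable Td) (hu : Measurable Tu) :
    Measurable (upWeight Td Tu) :=
  .ite (measurableSet_lt hd hu) (by fun_prop) measurable_const

/-- The image of `μ` under the two-point kernel with atoms `T_u`, `T_d` and weight `q`. -/
theorem bind_twoPoint_apply (μ : Measure ℝ) {Td Tu : ℝ → ℝ} (hd : Measurable Td)
    (hu : Measurable Tu) {E : Set (ℝ × ℝ)} (hE : MeasurableSet E) :
    (μ.bind fun x ↦ ENNReal.ofReal (upWeight Td Tu x) • Measure.dirac (x, Tu x) +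
      ENNReal.ofReal (1 - upWeight Td Tu x) • Measure.dirac (x, Td x)) E =
    ∫⁻ x, ENNReal.ofReal (upWeight Td Tu x) * E.indicator 1 (x, Tu x) +
      ENNReal.ofReal (1 - upWeight Td Tu x) * E.indicator 1 (x, Td x) ∂μ := by
  have hq := measurable_upWeight hd hu
  rw [Measure.bind_apply hE]
  · refine lintegral_congr fun x ↦ ?_
    simp [Measure.dirac_apply' _ hE]
  · refine (Measure.measurable_of_measurable_coe _ fun A hA ↦ ?_).aemeasurable
    simp only [Measure.coe_add, Measure.coe_smul, Pi.add_apply, Pi.smul_apply, smul_eq_mul,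
      Measure.dirac_apply' _ hA]
    have h1 : Measurable (A.indicator (1 : ℝ × ℝ → ℝ≥0∞)) := measurable_one.indicator hA
    exact (hq.ennreal_ofReal.mul (h1.comp (measurable_id.prodMk hu))).add
      ((measurable_const.sub hq).ennreal_ofReal.mul (h1.comp (measurable_id.prodMk hd)))

/-- A real function is determined measurably by the rationals above its values. -/
theorem exists_measurable_of_forall_rat {α : Type*} [MeasurableSpace α] {p : ℚ → Set α}
    (hp : ∀ q, MeasurableSet (p q)) :
    ∃ T : α → ℝ, Measurable T ∧ ∀ x (d : ℝ), (∀ q : ℚ, x ∈ p q ↔ d ≤ q) → T x = d := by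
  classical
  -- The infimum is taken in `EReal`, with `⊤` for rejected rationals, so that it is measurable with
  -- no boundedness condition; `toReal` gives arbitrary values where the hypothesis on `x` fails.
  refine ⟨fun x ↦ (⨅ q : ℚ, if x ∈ p q then ((q : ℝ) : EReal) else ⊤).toReal, ?_, ?_⟩
  · exact (Measurable.iInf fun q ↦ .ite (hp q) measurable_const measurable_const).ereal_toReal
  · intro x d h
    suffices (⨅ q : ℚ, if x ∈ p q then ((q : ℝ) : EReal) else ⊤) = d by simp [this]
    refine iInf_eq_of_forall_ge_of_forall_gt_exists_lt (fun q ↦ ?_) fun b hb ↦ ?_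
    · split_ifs with hq
      · exact_mod_cast (h q).1 hq
      · exact le_top
    · obtain ⟨q, hq, hqb⟩ := EReal.lt_iff_exists_rat_btwn.1 hb
      have hdq : d ≤ q := by exact_mod_cast hq.le
      exact ⟨q, by rwa [if_pos ((h q).2 hdq)]⟩

theorem eq_smul_dirac_add_smul_dirac {m : Measure ℝ} {d u : ℝ} (hdu : d ≠ u)
    (h : ∀ᵐ y ∂m, y = u ∨ y = d) :
    m = m {u} • Measure.dirac u + m {d} • Measure.dirac d := by
  rw [← Measure.restrict_singleton, ← Measure.restrict_singleton,
    ← Measure.restrict_union (by simpa using hdu.symm) (measurableSet_singleton d)]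
  exact (Measure.restrict_eq_self_of_ae_mem (by simpa [or_comm] using h)).symm

/-- A probability measure with mean `x` carried by a set without three distinct points is a
two-point (or Dirac) measure with atoms on both sides of `x`. -/
theorem exists_twoPoint {m : Measure ℝ} [IsProbabilityMeasure m] {G : Set ℝ} {x : ℝ}
    (hG : ∀ᵐ y ∂m, y ∈ G)
    (hG3 : ∀ y₀ ∈ G, ∀ y₁ ∈ G, ∀ y₂ ∈ G, y₀ < y₁ → y₁ < y₂ → False)
    (hint : Integrable (fun y ↦ y) m) (hmean : ∫ y, y ∂m = x) :
    ∃ d ∈ G, ∃ u ∈ G, d ≤ x ∧ x ≤ u ∧ (d = x ↔ u = x) ∧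
      m = ENNReal.ofReal (if d < u then (x - d) / (u - d) else 0) • Measure.dirac u +
        ENNReal.ofReal (1 - if d < u then (x - d) / (u - d) else 0) • Measure.dirac d ∧
      (∀ a, 0 < m (Iic a) ↔ d ≤ a) ∧ ∀ a, 0 < m (Ici a) ↔ a ≤ u := by
  have hintx : Integrable (fun y ↦ y - x) m := hint.sub (integrable_const x)
  have hint0 : ∫ y, (y - x) ∂m = 0 := by
    rw [integral_sub hint (integrable_const x), hmean]; simp
  by_cases hx : ∀ᵐ y ∂m, y = x
  · have hm : m = Measure.dirac x := by
      have := Measure.restrict_eq_self_of_ae_mem (s := {x}) hx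
      rw [Measure.restrict_singleton, (prob_compl_eq_zero_iff (measurableSet_singleton x)).1 hx,
        one_smul] at this
      exact this.symm
    obtain ⟨y, hy, rfl⟩ := (hG.and hx).exists
    refine ⟨y, hy, y, hy, le_rfl, le_rfl, Iff.rfl, by simpa using hm, fun a ↦ ?_, fun a ↦ ?_⟩
    · rw [hm, Measure.dirac_apply' _ measurableSet_Iic]
      by_cases h : y ≤ a <;> simp [h]
    · rw [hm, Measure.dirac_apply' _ measurableSet_Ici]
      by_cases h : a ≤ y <;> simp [h]
  -- A measure that is not the Dirac mass at its mean charges both sides of it.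
  · have hlt : ∃ᵐ y ∂m, y < x := by
      intro h
      refine hx ?_
      have := (integral_eq_zero_iff_of_nonneg_ae (h.mono fun y hy ↦ by
        simpa using hy) hintx).1 hint0
      exact this.mono fun y hy ↦ by simpa [sub_eq_zero] using hy
    have hgt : ∃ᵐ y ∂m, x < y := by
      intro h
      refine hx ?_
      have := (integral_eq_zero_iff_of_nonneg_ae (f := fun y ↦ -(y - x)) (h.mono fun y hy ↦ by
        simpa using hy) hintx.neg).1 (by rw [integral_neg, hint0, neg_zero])
      exact this.mono fun y hy ↦ by simpa [sub_eq_zero, eq_comm] using hy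
    obtain ⟨d, hdx, hd⟩ := (hlt.and_eventually hG).exists
    obtain ⟨u, hux, hu⟩ := (hgt.and_eventually hG).exists
    have hdu : d < u := hdx.trans hux
    have hae : ∀ᵐ y ∂m, y = u ∨ y = d := by
      filter_upwards [hG] with y hy
      by_contra! hne
      rcases lt_or_gt_of_ne hne.1 with h1 | h1
      · rcases lt_or_gt_of_ne hne.2 with h2 | h2
        · exact hG3 y hy d hd u hu h2 hdu
        · exact hG3 d hd y hy u hu h2 h1
      · exact hG3 d hd u hu y hy hdu h1
    have hm := eq_smul_dirac_add_smul_dirac hdu.ne hae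
    have hsum : m.real {u} + m.real {d} = 1 := by
      have := congrArg (fun m' : Measure ℝ ↦ m'.real univ) hm
      simp only [probReal_univ] at this
      rw [this, Measure.real, Measure.real, Measure.real,
        ← ENNReal.toReal_add (measure_ne_top _ _) (measure_ne_top _ _)]
      simp
    have hbar : m.real {u} * u + m.real {d} * d = x := by
      rw [← hmean]
      conv_rhs => rw [hm]
      rw [integral_add_measure, integral_smul_measure, integral_smul_measure, integral_dirac,
        integral_dirac]
      · rfl
      · exact (integrable_dirac (by simp)).smul_measure (measure_ne_top _ _)
      · exact (integrable_dirac (by simp)).smul_measure (measure_ne_top _ _)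
    have hne : u - d ≠ 0 := (sub_pos.2 hdu).ne'
    have hmu : m.real {u} = (x - d) / (u - d) := by
      rw [eq_div_iff hne]; linear_combination hbar - d * hsum
    have hmd : m.real {d} = 1 - (x - d) / (u - d) := by rw [← hmu]; linarith
    have hmu' : m {u} = ENNReal.ofReal ((x - d) / (u - d)) := by
      rw [← hmu, ofReal_measureReal]
    have hmd' : m {d} = ENNReal.ofReal (1 - (x - d) / (u - d)) := by
      rw [← hmd, ofReal_measureReal]
    have hpu : 0 < m {u} := by
      rw [hmu', ENNReal.ofReal_pos]; exact div_pos (sub_pos.2 hdx) (sub_pos.2 hdu)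
    have hpd : 0 < m {d} := by
      rw [hmd', ENNReal.ofReal_pos, sub_pos, div_lt_one (sub_pos.2 hdu)]; linarith
    refine ⟨d, hd, u, hu, hdx.le, hux.le, ?_, ?_, fun a ↦ ?_, fun a ↦ ?_⟩
    · simp [hdx.ne, hux.ne']
    · simp only [if_pos hdu]
      rw [← hmu', ← hmd']; exact hm
    · refine ⟨fun h ↦ ?_, fun h ↦ hpd.trans_le (measure_mono (by simpa using h))⟩
      by_contra! hlt
      refine h.ne' (measure_eq_zero_iff_ae_notMem.2 ?_)
      filter_upwards [hae] with y hy
      rcases hy with rfl | rfl <;> simp only [mem_Iic] <;> linarith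
    · refine ⟨fun h ↦ ?_, fun h ↦ hpu.trans_le (measure_mono (by simpa using h))⟩
      by_contra! hlt
      refine h.ne' (measure_eq_zero_iff_ae_notMem.2 ?_)
      filter_upwards [hae] with y hy
      rcases hy with rfl | rfl <;> simp only [mem_Ici] <;> linarith

/-- A triple `y₀ < y₁ < y₂` over `x` is labelled by rationals in its two gaps. If two points share a
label, the middle point over the larger one lies strictly between the outer points over the smaller
one, which `hΓ` forbids. -/
theorem countable_three_points {Γ : Set (ℝ × ℝ)}
    (hΓ : ∀ x y₀ y₁ x' y' : ℝ, (x, y₀) ∈ Γ → (x, y₁) ∈ Γ → (x', y') ∈ Γ → x < x' →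
      y' ∉ Ioo y₀ y₁) :
    {x | ∃ y₀ y₁ y₂, (x, y₀) ∈ Γ ∧ (x, y₁) ∈ Γ ∧ (x, y₂) ∈ Γ ∧ y₀ < y₁ ∧ y₁ < y₂}.Countable := by
  refine countable_of_forall_exists_label (fun x (q : ℚ × ℚ) ↦ ∃ y₀ y₁ y₂, (x, y₀) ∈ Γ ∧
    (x, y₁) ∈ Γ ∧ (x, y₂) ∈ Γ ∧ y₀ < q.1 ∧ q.1 < y₁ ∧ y₁ < q.2 ∧ q.2 < y₂) ?_ ?_
  · rintro x ⟨y₀, y₁, y₂, h0, h1, h2, h01, h12⟩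
    obtain ⟨q, hq, hq'⟩ := exists_rat_btwn h01
    obtain ⟨r, hr, hr'⟩ := exists_rat_btwn h12
    exact ⟨(q, r), y₀, y₁, y₂, h0, h1, h2, hq, hq', hr, hr'⟩
  · rintro x - x' - ⟨q, r⟩ ⟨y₀, y₁, y₂, h0, h1, h2, ha, hb, hc, hd⟩
      ⟨z₀, z₁, z₂, k0, k1, k2, ka, kb, kc, kd⟩
    by_contra hne
    rcases lt_or_gt_of_ne hne with hlt | hlt
    · exact hΓ x y₀ y₂ x' z₁ h0 h2 k1 hlt ⟨ha.trans kb, kc.trans hd⟩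
    · exact hΓ x' z₀ z₂ x y₁ k0 k2 h1 hlt ⟨ka.trans hb, hc.trans kd⟩

theorem IsMartingalePlan.exists_disintegration {μ ν : Measure ℝ} {P : Measure (ℝ × ℝ)}
    (hν : Integrable id ν) (hP : IsMartingalePlan μ ν P) :
    ∃ κ : Kernel ℝ ℝ, IsMarkovKernel κ ∧ μ ⊗ₘ κ = P ∧
      ∀ᵐ x ∂μ, Integrable (fun y ↦ y) (κ x) ∧ ∫ y, y ∂(κ x) = x := by
  have := hP.isProbabilityMeasure
  have hcomp : μ ⊗ₘ condDistrib Prod.snd Prod.fst P = P := by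
    rw [← hP.map_fst, compProd_map_condDistrib measurable_snd.aemeasurable]
    exact Measure.map_id
  have : IsProbabilityMeasure μ := by
    rw [← hP.map_fst]; exact Measure.isProbabilityMeasure_map measurable_fst.aemeasurable
  have hint : Integrable (Prod.snd : ℝ × ℝ → ℝ) P := by
    rw [← hP.map_snd] at hν
    exact hν.comp_measurable measurable_snd
  refine ⟨condDistrib Prod.snd Prod.fst P, inferInstance, hcomp, ?_⟩
  have h1 : ∀ᵐ x ∂μ, Integrable (fun y ↦ y) (condDistrib Prod.snd Prod.fst P x) := by
    rw [← hcomp] at hint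
    exact ((Measure.integrable_compProd_iff hint.1).1 hint).1
  have h2 : ∀ᵐ p ∂P, ∫ y, y ∂(condDistrib Prod.snd Prod.fst P p.1) = p.1 :=
    (condExp_ae_eq_integral_condDistrib' measurable_fst hint).symm.trans hP.condExp_snd
  have h3 : ∀ᵐ p ∂(μ ⊗ₘ condDistrib Prod.snd Prod.fst P),
      ∫ y, y ∂(condDistrib Prod.snd Prod.fst P p.1) = p.1 := by rwa [hcomp]
  filter_upwards [h1, Measure.ae_ae_of_ae_compProd h3] with x hx hx'
  exact ⟨hx, hx'.exists.choose_spec⟩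

theorem IsMartingalePlan.exists_isMonotonePair {μ ν : Measure ℝ} {P : Measure (ℝ × ℝ)}
    (hatom : ∀ x : ℝ, μ {x} = 0) (hν : Integrable id ν) (hP : IsMartingalePlan μ ν P)
    (hmono : IsLeftMonotone P) :
    ∃ (S : Set ℝ) (Td Tu : ℝ → ℝ), IsMonotonePair μ P S Td Tu := by
  have := hP.isProbabilityMeasure
  have : IsProbabilityMeasure μ := by
    rw [← hP.map_fst]; exact Measure.isProbabilityMeasure_map measurable_fst.aemeasurable
  have : NullSingletonClass μ := ⟨hatom⟩
  obtain ⟨κ, hκ, hcomp, hmean⟩ := hP.exists_disintegration hν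
  obtain ⟨Γ, hΓm, hPΓ, hΓ⟩ := hmono
  have hΓae : ∀ᵐ x ∂μ, ∀ᵐ y ∂(κ x), (x, y) ∈ Γ := by
    have : ∀ᵐ p ∂P, p ∈ Γ := (mem_ae_iff_prob_eq_one hΓm).2 hPΓ
    rw [← hcomp] at this
    exact Measure.ae_ae_of_ae_compProd this
  obtain ⟨Td, hTdm, hTd⟩ := exists_measurable_of_forall_rat
    (p := fun q ↦ {x | 0 < κ x (Iic (q : ℝ))})
    fun q ↦ measurableSet_lt measurable_const (κ.measurable_coe measurableSet_Iic)
  -- Reflection: the upper atom is recovered as minus the least `b` with mass on `Ici (-b)`.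
  obtain ⟨Tn, hTnm, hTn⟩ := exists_measurable_of_forall_rat
    (p := fun q ↦ {x | 0 < κ x (Ici (-(q : ℝ)))})
    fun q ↦ measurableSet_lt measurable_const (κ.measurable_coe measurableSet_Ici)
  set Tu : ℝ → ℝ := fun x ↦ -Tn x with hTu
  have hTum : Measurable Tu := hTnm.neg
  have hgood : ∀ᵐ x ∂μ, (x, Td x) ∈ Γ ∧ (x, Tu x) ∈ Γ ∧ Td x ≤ x ∧ x ≤ Tu x ∧
      (Td x = x ↔ Tu x = x) ∧ κ x = ENNReal.ofReal (upWeight Td Tu x) • Measure.dirac (Tu x) +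
        ENNReal.ofReal (1 - upWeight Td Tu x) • Measure.dirac (Td x) := by
    have h3 := (countable_three_points hΓ).measure_zero μ
    filter_upwards [hΓae, hmean, measure_eq_zero_iff_ae_notMem.1 h3] with x hx hxm hx3
    obtain ⟨d, hd, u, hu, hdx, hxu, hiff, heq, hIic, hIci⟩ := exists_twoPoint
      (G := {y | (x, y) ∈ Γ})
      hx (fun y₀ h₀ y₁ h₁ y₂ h₂ h01 h12 ↦ hx3 ⟨y₀, y₁, y₂, h₀, h₁, h₂, h01, h12⟩) hxm.1 hxm.2
    obtain rfl : Td x = d := hTd x d fun q ↦ hIic q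
    have hTux : Tu x = u := by
      rw [hTu, neg_eq_iff_eq_neg]
      exact hTn x (-u) fun q ↦ (hIci (-q)).trans neg_le
    subst hTux
    exact ⟨hd, hu, hdx, hxu, hiff, heq⟩
  -- Discarding a Borel null set makes the pointwise conditions hold at every point of `S = Nᶜ`.
  obtain ⟨N, hN, hNm, hN0⟩ := exists_measurable_superset_of_null hgood
  have hS : ∀ x ∈ Nᶜ, _ := fun x hx ↦ not_not.1 fun h ↦ hx (hN h)
  refine ⟨Nᶜ, Td, Tu, hNm.compl, by simpa using hN0, hTdm, hTum, fun x hx ↦ (hS x hx).2.2.1,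
    fun x hx ↦ (hS x hx).2.2.2.1, fun x hx ↦ (hS x hx).2.2.2.2.1, ?_, ?_, ?_⟩
  · ext E hE
    rw [bind_twoPoint_apply μ hTdm hTum hE, ← hcomp, Measure.compProd_apply hE]
    refine lintegral_congr_ae ?_
    filter_upwards [hgood] with x hx
    rw [hx.2.2.2.2.2]
    simp only [Measure.coe_add, Measure.coe_smul, Pi.add_apply, Pi.smul_apply, smul_eq_mul,
      Measure.dirac_apply' _ (measurable_prodMk_left hE)]
    rfl
  · intro x hx y hy hxy
    rcases hxy.eq_or_lt with rfl | hlt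
    · exact le_rfl
    by_contra! hTlt
    obtain ⟨hxd, hxu, hdx, hux, hiff, -⟩ := hS x hx
    obtain ⟨-, hyu, -, hyTu, -, -⟩ := hS y hy
    exact hΓ x _ _ y _ hxd hxu hyu hlt ⟨by linarith, hTlt⟩
  · intro x hx y hy hlt
    exact hΓ x _ _ y _ (hS x hx).1 (hS x hx).2.1 (hS y hy).1 hlt

/-! ### Optional stopping in continuous time -/

open Filter Topology TopologicalSpace

theorem WithTop.coe_untopA_of_ne_top {α : Type*} [Nonempty α] {x : WithTop α} (h : x ≠ ⊤) :
    (x.untopA : WithTop α) = x := by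
  rw [WithTop.untopA_eq_untop h, WithTop.coe_untop]

/-- The smallest multiple of `1 / (k + 1)` greater than `t`, capped at `N`. -/
noncomputable def gridAbove (N : ℝ≥0) (k : ℕ) (t : ℝ≥0) : ℝ≥0 :=
  min N ((⌊(k + 1) * t⌋₊ + 1) / (k + 1))

theorem gridAbove_le (N : ℝ≥0) (k : ℕ) (t : ℝ≥0) : gridAbove N k t ≤ N := min_le_left _ _

theorem le_gridAbove {N t : ℝ≥0} (k : ℕ) (h : t ≤ N) : t ≤ gridAbove N k t := by
  refine le_min h ?_
  rw [le_div_iff₀ (by positivity), mul_comm]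
  exact (Nat.lt_floor_add_one _).le

/-- Below the cap, the event that the discretised time is at most `s` is a strict event for the
original time, at a grid point not exceeding `s`. -/
theorem gridAbove_le_iff {N s t : ℝ≥0} (k : ℕ) (h : s < N) :
    gridAbove N k t ≤ s ↔ t < (⌊(k + 1) * s⌋₊ : ℝ≥0) / (k + 1) := by
  rw [gridAbove, min_le_iff, or_iff_right h.not_ge, div_le_iff₀ (by positivity),
    lt_div_iff₀ (by positivity), mul_comm s, mul_comm t]
  have hcast : (⌊(k + 1) * t⌋₊ : ℝ≥0) + 1 = ((⌊(k + 1) * t⌋₊ + 1 : ℕ) : ℝ≥0) := by push_cast; rfl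
  rw [hcast, ← Nat.le_floor_iff zero_le, Nat.succ_le_iff, Nat.floor_lt zero_le]

theorem tendsto_gridAbove {N t : ℝ≥0} (h : t ≤ N) :
    Tendsto (fun k ↦ gridAbove N k t) atTop (𝓝 t) := by
  have h1 : Tendsto (fun k : ℕ ↦ t + 1 / ((k : ℝ≥0) + 1)) atTop (𝓝 (t + 0)) :=
    tendsto_const_nhds.add tendsto_one_div_add_atTop_nhds_zero_nat
  rw [add_zero] at h1
  refine tendsto_of_tendsto_of_tendsto_of_le_of_le tendsto_const_nhds h1
    (fun k ↦ le_gridAbove k h) fun k ↦ (min_le_right _ _).trans ?_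
  have hk : (t + 1 / ((k : ℝ≥0) + 1)) * (k + 1) = (k + 1) * t + 1 := by
    rw [add_mul, div_mul_cancel₀ _ (by positivity), mul_comm t]
  rw [div_le_iff₀ (by positivity), hk]
  gcongr
  exact Nat.floor_le (by positivity)

theorem countable_range_gridAbove (N : ℝ≥0) (k : ℕ) : (range (gridAbove N k)).Countable := by
  refine (countable_range fun j : ℕ ↦ min N (((j : ℝ≥0) + 1) / (k + 1))).mono ?_
  rintro _ ⟨t, rfl⟩
  exact ⟨_, rfl⟩

section Stopping

variable {Ω : Type*} {mΩ : MeasurableSpace Ω} {Q : Measure Ω} {𝓕 : Filtration ℝ≥0 mΩ}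
  {B : ℝ≥0 → Ω → ℝ} {σ τ : Ω → WithTop ℝ≥0}

theorem isStoppingTime_gridAbove (hτ : IsStoppingTime 𝓕 τ) {N : ℝ≥0} (hN : ∀ ω, τ ω ≤ N) (k : ℕ) :
    IsStoppingTime 𝓕 fun ω ↦ (gridAbove N k (τ ω).untopA : WithTop ℝ≥0) := by
  intro s
  rcases le_or_gt N s with h | h
  · convert MeasurableSet.univ
    ext ω
    simpa only [mem_ofPred_eq, mem_univ, iff_true, WithTop.coe_le_coe] using
      (gridAbove_le _ _ _).trans h
  · have : {ω | ((gridAbove N k (τ ω).untopA : ℝ≥0) : WithTop ℝ≥0) ≤ s} =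
        {ω | τ ω < (((⌊(k + 1) * s⌋₊ : ℝ≥0) / (k + 1) : ℝ≥0) : WithTop ℝ≥0)} := by
      ext ω
      simp only [mem_ofPred_eq, WithTop.coe_le_coe, gridAbove_le_iff k h]
      rw [WithTop.untopA_lt_iff]
      exact ne_top_of_le_ne_top WithTop.coe_ne_top (hN ω)
    rw [this]
    refine 𝓕.mono ?_ _ (hτ.measurableSet_lt _)
    rw [div_le_iff₀ (by positivity), mul_comm s]
    exact Nat.floor_le (by positivity)

/-- **Optional stopping** for a continuous martingale and a bounded stopping time. -/
theorem MeasureTheory.Martingale.setIntegral_stoppedValue_of_le_const [IsFiniteMeasure Q]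
    (hB : Martingale B 𝓕 Q) (hc : ∀ ω, Continuous (B · ω)) (hτ : IsStoppingTime 𝓕 τ) {N : ℝ≥0}
    (hN : ∀ ω, τ ω ≤ N) {E : Set Ω} (hE : MeasurableSet[hτ.measurableSpace] E) :
    ∫ ω in E, stoppedValue B τ ω ∂Q = ∫ ω in E, B N ω ∂Q := by
  have hτtop : ∀ ω, τ ω ≠ ⊤ := fun ω ↦ ne_top_of_le_ne_top WithTop.coe_ne_top (hN ω)
  have hτN : ∀ ω, (τ ω).untopA ≤ N := fun ω ↦ (WithTop.untopA_le_iff (hτtop ω)).2 (hN ω)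
  set τ' : ℕ → Ω → WithTop ℝ≥0 := fun k ω ↦ (gridAbove N k (τ ω).untopA : WithTop ℝ≥0) with hτ'
  have hst : ∀ k, IsStoppingTime 𝓕 (τ' k) := isStoppingTime_gridAbove hτ hN
  have hτ'N : ∀ k ω, τ' k ω ≤ N := fun k ω ↦ WithTop.coe_le_coe.2 (gridAbove_le _ _ _)
  have hle : ∀ k, τ ≤ τ' k := fun k ω ↦ by
    rw [hτ', ← WithTop.untopA_le_iff (hτtop ω)]
    exact le_gridAbove k (hτN ω)
  have hcond : ∀ k, stoppedValue B (τ' k) =ᵐ[Q] Q[B N | (hst k).measurableSpace] := fun k ↦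
    hB.stoppedValue_ae_eq_condExp_of_le_const_of_countable_range (hst k) (hτ'N k)
      (((countable_range_gridAbove N k).image (fun t : ℝ≥0 ↦ (t : WithTop ℝ≥0))).mono (by
        rintro _ ⟨ω, rfl⟩; exact ⟨_, ⟨_, rfl⟩, rfl⟩))
  have hlim : ∀ ω, Tendsto (fun k ↦ stoppedValue B (τ' k) ω) atTop (𝓝 (stoppedValue B τ ω)) :=
    fun ω ↦ ((hc ω).tendsto _).comp (tendsto_gridAbove (hτN ω))
  -- The values at the discretised times are conditional expectations of the single variable `B N`,
  -- so pointwise convergence along continuous paths upgrades to convergence in `L¹`.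
  have hui : UniformIntegrable (fun k ↦ stoppedValue B (τ' k)) 1 Q :=
    ((hB.integrable N).uniformIntegrable_condExp fun k ↦ (hst k).measurableSpace_le).ae_eq
      fun k ↦ (hcond k).symm
  have hmem : MemLp (stoppedValue B τ) 1 Q :=
    hui.memLp_of_ae_tendsto (ae_of_all _ hlim)
  have hL1 := tendsto_Lp_finite_of_tendsto_ae le_rfl ENNReal.one_ne_top hui.1 hmem hui.2.1
    (ae_of_all _ hlim)
  have hint := tendsto_setIntegral_of_L1' (stoppedValue B τ) hmem.1
    (Eventually.of_forall fun k ↦ memLp_one_iff_integrable.1 (hui.memLp k)) hL1 E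
  refine tendsto_nhds_unique hint (tendsto_const_nhds.congr fun k ↦ ?_)
  have hEk : MeasurableSet[(hst k).measurableSpace] E :=
    hτ.measurableSpace_mono (hst k) (hle k) _ hE
  rw [setIntegral_congr_ae (hτ.measurableSpace_le _ hE) ((hcond k).mono fun ω h _ ↦ h),
    setIntegral_condExp _ (hB.integrable N) hEk]

/-- **Optional stopping** on an event known at time `0` on which the martingale is bounded up to
the stopping time. -/
theorem MeasureTheory.Martingale.setIntegral_stoppedValue_eq [IsFiniteMeasure Q]
    (hB : Martingale B 𝓕 Q) (hc : ∀ ω, Continuous (B · ω)) (hσ : IsStoppingTime 𝓕 σ)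
    (hτ : IsStoppingTime 𝓕 τ) (hle : σ ≤ τ) (hfin : ∀ᵐ ω ∂Q, τ ω ≠ ⊤) {A : Set Ω}
    (hA : MeasurableSet[𝓕 0] A) {c : ℝ} (hb : ∀ ω ∈ A, ∀ t : ℝ≥0, t ≤ τ ω → |B t ω| ≤ c)
    {E : Set Ω} (hE : MeasurableSet[hσ.measurableSpace] E) :
    ∫ ω in A ∩ E, stoppedValue B σ ω ∂Q = ∫ ω in A ∩ E, stoppedValue B τ ω ∂Q := by
  have hprog : IsStronglyProgressive 𝓕 B :=
    hB.stronglyAdapted.isStronglyProgressive_of_continuous hc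
  have hAE : MeasurableSet[hσ.measurableSpace] (A ∩ E) :=
    (hσ.le_measurableSpace_of_const_le (fun ω ↦ bot_le) _ hA).inter hE
  -- The integrals on the left do not involve `ρ`: on `{σ ≤ n}`, optional stopping at `min ρ n`
  -- replaces the stopped value by `B n`. Taking `ρ = σ` and `ρ = τ` then gives two limits of one
  -- sequence.
  have key : ∀ ρ : Ω → WithTop ℝ≥0, IsStoppingTime 𝓕 ρ → σ ≤ ρ → ρ ≤ τ →
      Tendsto (fun n : ℕ ↦ ∫ ω in A ∩ E ∩ {ω | σ ω ≤ ((n : ℝ≥0) : WithTop ℝ≥0)}, B n ω ∂Q) atTop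
        (𝓝 (∫ ω in A ∩ E, stoppedValue B ρ ω ∂Q)) := by
    intro ρ hρ hσρ hρτ
    have hm : ∀ n : ℕ, MeasurableSet (A ∩ E ∩ {ω | σ ω ≤ ((n : ℝ≥0) : WithTop ℝ≥0)}) := fun n ↦
      (hσ.measurableSpace_le _ hAE).inter (𝓕.le _ _ (hσ n))
    have heq : ∀ n : ℕ, ∫ ω in A ∩ E ∩ {ω | σ ω ≤ ((n : ℝ≥0) : WithTop ℝ≥0)}, B n ω ∂Q =
        ∫ ω, (A ∩ E ∩ {ω | σ ω ≤ ((n : ℝ≥0) : WithTop ℝ≥0)}).indicator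
          (stoppedValue B fun ω ↦ min (ρ ω) (n : ℝ≥0)) ω ∂Q := by
      intro n
      rw [integral_indicator (hm n),
        hB.setIntegral_stoppedValue_of_le_const hc (hρ.min_const n) (fun ω ↦ min_le_right _ _)]
      refine (hσ.min_const n).measurableSpace_mono (hρ.min_const n)
        (fun ω ↦ min_le_min_right _ (hσρ ω)) _ ?_
      rw [← hσ.measurableSet_inter_le_const_iff]
      exact hAE.inter (hσ.measurableSet_le' n)
    simp_rw [heq]
    rw [← integral_indicator (hσ.measurableSpace_le _ hAE)]
    refine tendsto_integral_of_dominated_convergence (fun _ ↦ |c|) (fun n ↦ ?_)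
      (integrable_const _) (fun n ↦ ae_of_all _ fun ω ↦ ?_) ?_
    · exact ((((measurable_stoppedValue hprog (hρ.min_const n)).mono
        (hρ.min_const n).measurableSpace_le le_rfl).indicator (hm n))).aestronglyMeasurable
    · by_cases hω : ω ∈ A ∩ E ∩ {ω | σ ω ≤ ((n : ℝ≥0) : WithTop ℝ≥0)}
      · rw [indicator_of_mem hω, Real.norm_eq_abs]
        refine (hb ω hω.1.1 _ ?_).trans (le_abs_self c)
        rw [WithTop.coe_untopA_of_ne_top
          (ne_top_of_le_ne_top WithTop.coe_ne_top (min_le_right _ _))]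
        exact (min_le_left _ _).trans (hρτ ω)
      · rw [indicator_of_notMem hω]; simp
    · filter_upwards [hfin] with ω hω
      have hρω : ρ ω ≠ ⊤ := ne_top_of_le_ne_top hω (hρτ ω)
      obtain ⟨r, hr⟩ := WithTop.ne_top_iff_exists.1 hρω
      obtain ⟨m, hm⟩ := exists_nat_ge r
      refine tendsto_const_nhds.congr' ?_
      filter_upwards [eventually_ge_atTop m] with n hn
      have hrn : ρ ω ≤ ((n : ℝ≥0) : WithTop ℝ≥0) := by
        rw [← hr]; exact_mod_cast hm.trans (by exact_mod_cast hn)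
      have hmem : ω ∈ {ω | σ ω ≤ ((n : ℝ≥0) : WithTop ℝ≥0)} := (hσρ ω).trans hrn
      by_cases hAEω : ω ∈ A ∩ E
      · rw [indicator_of_mem hAEω, indicator_of_mem (mem_inter hAEω hmem), stoppedValue,
          stoppedValue, min_eq_left hrn]
      · rw [indicator_of_notMem hAEω, indicator_of_notMem fun h ↦ hAEω h.1]
  exact tendsto_nhds_unique (key σ hσ le_rfl hle) (key τ hτ hle le_rfl)

end Stopping

/-! ### Hitting times of a single path -/

section Paths

/-- The first time after `0` at which a path is negative. -/
noncomputable def firstNegTime (z : ℝ≥0 → ℝ) : WithTop ℝ≥0 :=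
  sInf ((fun t : ℝ≥0 ↦ (t : WithTop ℝ≥0)) '' {t : ℝ≥0 | 0 < t ∧ z t < 0})

theorem firstNegTime_le {z : ℝ≥0 → ℝ} {t : ℝ≥0} (ht : 0 < t) (hz : z t < 0) :
    firstNegTime z ≤ t := sInf_le ⟨t, ⟨ht, hz⟩, rfl⟩

theorem firstNegTime_lt_iff {z : ℝ≥0 → ℝ} {T : WithTop ℝ≥0} :
    firstNegTime z < T ↔ ∃ t : ℝ≥0, t < T ∧ 0 < t ∧ z t < 0 := by
  rw [firstNegTime, sInf_lt_iff]
  constructor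
  · rintro ⟨_, ⟨t, ht, rfl⟩, htT⟩
    exact ⟨t, htT, ht⟩
  · rintro ⟨t, htT, ht⟩
    exact ⟨_, ⟨t, ht, rfl⟩, htT⟩

theorem nonneg_of_le_of_forall_lt {z : ℝ≥0 → ℝ} (hz : Continuous z) (h0 : 0 ≤ z 0)
    {T : WithTop ℝ≥0} (hT : ∀ s : ℝ≥0, 0 < s → s < T → 0 ≤ z s) {t : ℝ≥0} (ht : t ≤ T) :
    0 ≤ z t := by
  rcases eq_zero_or_pos t with rfl | hpos
  · exact h0
  by_contra! hneg
  obtain ⟨l, hl, hlt⟩ := exists_Ioc_subset_of_mem_nhds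
    ((isOpen_lt hz continuous_const).mem_nhds hneg) ⟨0, hpos⟩
  obtain ⟨s, hls, hst⟩ := exists_between hl
  exact (hT s (zero_le.trans_lt hls) ((WithTop.coe_lt_coe.2 hst).trans_le ht)).not_gt
    (hlt ⟨hls, hst.le⟩)

theorem nonneg_of_le_firstNegTime {z : ℝ≥0 → ℝ} (hz : Continuous z) (h0 : 0 ≤ z 0) {t : ℝ≥0}
    (ht : t ≤ firstNegTime z) : 0 ≤ z t := by
  refine nonneg_of_le_of_forall_lt hz h0 (fun s hs hsT ↦ ?_) ht
  by_contra! h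
  exact (firstNegTime_le hs h).not_gt hsT

theorem exists_denseSeq_btwn {T U : WithTop ℝ≥0} (h : T < U) :
    ∃ i, T < (denseSeq ℝ≥0 i : WithTop ℝ≥0) ∧ (denseSeq ℝ≥0 i : WithTop ℝ≥0) < U := by
  obtain ⟨V, hTV, hVU⟩ := exists_between h
  obtain ⟨v, rfl⟩ := WithTop.ne_top_iff_exists.1 (ne_top_of_lt hVU)
  obtain ⟨s, rfl⟩ := WithTop.ne_top_iff_exists.1 (ne_top_of_lt hTV)
  obtain ⟨i, hi⟩ := (denseRange_denseSeq ℝ≥0).exists_mem_open isOpen_Ioo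
    (nonempty_Ioo.2 (WithTop.coe_lt_coe.1 hTV))
  exact ⟨i, WithTop.coe_lt_coe.2 hi.1, (WithTop.coe_lt_coe.2 hi.2).trans hVU⟩

variable {Ω : Type*} {Z : ℝ≥0 → Ω → ℝ} {ω : Ω}

theorem hittingAfter_Iic_le_firstNegTime :
    hittingAfter Z (Iic 0) 0 ω ≤ firstNegTime (Z · ω) := by
  refine le_sInf ?_
  rintro _ ⟨t, ⟨-, ht⟩, rfl⟩
  exact hittingAfter_le_of_mem zero_le ht.le

theorem apply_hittingAfter_Iic (hc : Continuous (Z · ω)) {t : ℝ≥0}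
    (ht : hittingAfter Z (Iic 0) 0 ω = t) : Z t ω ≤ 0 := by
  have hex : ∃ j, 0 ≤ j ∧ Z j ω ∈ Iic 0 := by
    by_contra! h
    rw [hittingAfter_eq_top_iff.2 h] at ht
    exact WithTop.top_ne_coe ht
  rw [hittingAfter, if_pos hex, WithTop.coe_inj] at ht
  have hcl : IsClosed {i : ℝ≥0 | 0 ≤ i ∧ Z i ω ∈ Iic 0} :=
    (isClosed_le continuous_const continuous_id).inter (isClosed_Iic.preimage hc)
  rw [← ht]
  exact (hcl.csInf_mem hex (OrderBot.bddBelow _)).2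

theorem nonneg_of_le_hittingAfter_Iic (hc : Continuous (Z · ω)) (h0 : 0 ≤ Z 0 ω) {t : ℝ≥0}
    (ht : t ≤ hittingAfter Z (Iic 0) 0 ω) : 0 ≤ Z t ω :=
  nonneg_of_le_of_forall_lt hc h0
    (fun _ _ hs ↦ (not_le.1 (show _ ∉ Iic (0 : ℝ) from notMem_of_lt_hittingAfter hs zero_le)).le) ht

/-- Only countably many conditions on times up to `t` appear, because `min t` clamps the dense
sequence to `[0, t]`. Continuity gives one direction; the minimum over the compact `[0, t]` gives
the other. -/
theorem hittingAfter_Iic_le_iff (hc : Continuous (Z · ω)) {t : ℝ≥0} :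
    hittingAfter Z (Iic 0) 0 ω ≤ t ↔
      ∀ n : ℕ, ∃ i, Z (min t (denseSeq ℝ≥0 i)) ω < 1 / ((n : ℝ) + 1) := by
  constructor
  · intro h n
    obtain ⟨s, hs⟩ := WithTop.ne_top_iff_exists.1 (ne_top_of_le_ne_top WithTop.coe_ne_top h)
    have hst : s ≤ t := by rw [← hs] at h; exact WithTop.coe_le_coe.1 h
    have hopen : IsOpen {u | Z (min t u) ω < 1 / ((n : ℝ) + 1)} :=
      isOpen_lt (hc.comp (continuous_const.min continuous_id)) continuous_const
    refine (denseRange_denseSeq ℝ≥0).exists_mem_open hopen ⟨s, ?_⟩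
    rw [mem_ofPred_eq, min_eq_right hst]
    exact (apply_hittingAfter_Iic hc hs.symm).trans_lt (by positivity)
  · intro h
    obtain ⟨s, hs, hmin⟩ := (isCompact_Icc (a := 0) (b := t)).exists_isMinOn ⟨0, by simp⟩
      hc.continuousOn
    refine (hittingAfter_le_of_mem zero_le (i := s) ?_).trans (WithTop.coe_le_coe.2 hs.2)
    change Z s ω ≤ 0
    refine ge_of_tendsto' tendsto_one_div_add_atTop_nhds_zero_nat fun n ↦ ?_
    obtain ⟨i, hi⟩ := h n
    exact (hmin ⟨zero_le, min_le_left _ _⟩ : Z s ω ≤ _).trans hi.le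

end Paths

/-! ### Stopping times and absence of flat stretches -/

section StoppingTimes

variable {Ω : Type*} {mΩ : MeasurableSpace Ω} {Q : Measure Ω} {𝓕 : Filtration ℝ≥0 mΩ}
  {B Z : ℝ≥0 → Ω → ℝ} {σ τ : Ω → WithTop ℝ≥0}

theorem isStoppingTime_hittingAfter_Iic (hZ : Adapted 𝓕 Z) (hc : ∀ ω, Continuous (Z · ω)) :
    IsStoppingTime 𝓕 (hittingAfter Z (Iic 0) 0) := by
  intro t
  simp_rw [hittingAfter_Iic_le_iff (hc _), ofPred_forall, ofPred_exists]
  exact .iInter fun n ↦ .iUnion fun i ↦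
    measurableSet_lt ((hZ _).mono (𝓕.mono (min_le_left _ _)) le_rfl) measurable_const

theorem isStoppingTime_firstNegTime [𝓕.IsRightContinuous] (hZ : Adapted 𝓕 Z)
    (hc : ∀ ω, Continuous (Z · ω)) : IsStoppingTime 𝓕 fun ω ↦ firstNegTime (Z · ω) := by
  refine isStoppingTime_of_measurableSet_lt_of_isRightContinuous fun t ↦ ?_
  have : {ω | firstNegTime (Z · ω) < t} =
      ⋃ i, ⋃ _ : denseSeq ℝ≥0 i < t, {ω | 0 < denseSeq ℝ≥0 i ∧ Z (denseSeq ℝ≥0 i) ω < 0} := by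
    ext ω
    simp only [mem_ofPred_eq, mem_iUnion, exists_prop, firstNegTime_lt_iff]
    constructor
    · rintro ⟨s, hst, hs, hZs⟩
      have hopen : IsOpen {u : ℝ≥0 | u < t ∧ 0 < u ∧ Z u ω < 0} :=
        isOpen_Iio.inter (isOpen_Ioi.inter (isOpen_lt (hc ω) continuous_const))
      exact (denseRange_denseSeq ℝ≥0).exists_mem_open hopen ⟨s, WithTop.coe_lt_coe.1 hst, hs, hZs⟩
    · rintro ⟨i, hit, hi⟩
      exact ⟨_, WithTop.coe_lt_coe.2 hit, hi⟩
  rw [this]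
  exact .iUnion fun i ↦ .iUnion fun hi ↦ (MeasurableSet.const _).inter
    (measurableSet_lt ((hZ _).mono (𝓕.mono hi.le) le_rfl) measurable_const)

/-- If a process without intervals of constancy takes the same value at all stopping times between
`σ` and `τ`, then `σ = τ`. -/
theorem ae_eq_of_forall_stoppedValue_ae_eq
    (hinc : ∀ p r : ℝ≥0, p ≠ r → ∀ᵐ ω ∂Q, B p ω ≠ B r ω)
    (hσ : IsStoppingTime 𝓕 σ) (hτ : IsStoppingTime 𝓕 τ) (hle : σ ≤ τ)
    (h : ∀ ρ, IsStoppingTime 𝓕 ρ → σ ≤ ρ → ρ ≤ τ → stoppedValue B ρ =ᵐ[Q] stoppedValue B σ) :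
    σ =ᵐ[Q] τ := by
  -- Clamping deterministic times from a countable dense set to `[σ, τ]` yields enough stopping
  -- times: where `σ < τ`, two dense times fall strictly between and carry the same value.
  have h1 : ∀ᵐ ω ∂Q, ∀ i, stoppedValue B
      (fun ω ↦ min (τ ω) (max (σ ω) (denseSeq ℝ≥0 i))) ω = stoppedValue B σ ω :=
    ae_all_iff.2 fun i ↦ h _ (hτ.min (hσ.max_const _))
      (fun ω ↦ le_min (hle ω) (le_max_left _ _)) fun ω ↦ min_le_left _ _
  have h2 : ∀ᵐ ω ∂Q, ∀ i j, denseSeq ℝ≥0 i ≠ denseSeq ℝ≥0 j →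
      B (denseSeq ℝ≥0 i) ω ≠ B (denseSeq ℝ≥0 j) ω := by
    simp only [ae_all_iff]
    exact fun i j hij ↦ hinc _ _ hij
  filter_upwards [h1, h2] with ω h1 h2
  by_contra hne
  have hlt : σ ω < τ ω := (hle ω).lt_of_ne hne
  have hval : ∀ i, σ ω < (denseSeq ℝ≥0 i : WithTop ℝ≥0) → (denseSeq ℝ≥0 i : WithTop ℝ≥0) < τ ω →
      B (denseSeq ℝ≥0 i) ω = stoppedValue B σ ω := by
    intro i hi hi'
    rw [← h1 i, stoppedValue, max_eq_right hi.le, min_eq_right hi'.le]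
    rfl
  obtain ⟨i, hi, hi'⟩ := exists_denseSeq_btwn hlt
  obtain ⟨j, hj, hj'⟩ := exists_denseSeq_btwn hi'
  exact h2 i j (WithTop.coe_lt_coe.1 hj).ne ((hval i hi hi').trans (hval j (hi.trans hj) hj').symm)

end StoppingTimes

/-! ### Equality in Jensen's inequality between stopping times -/

namespace MeasureTheory.Martingale

variable {Ω : Type*} {mΩ : MeasurableSpace Ω} {Q : Measure Ω}
  {𝓕 : Filtration ℝ≥0 mΩ} {B : ℝ≥0 → Ω → ℝ} {σ τ : Ω → WithTop ℝ≥0}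

theorem measurable_stoppedValue_of_continuous (hB : Martingale B 𝓕 Q)
    (hc : ∀ ω, Continuous (B · ω)) (hτ : IsStoppingTime 𝓕 τ) :
    Measurable[hτ.measurableSpace] (stoppedValue B τ) :=
  measurable_stoppedValue (hB.stronglyAdapted.isStronglyProgressive_of_continuous hc) hτ

variable [IsProbabilityMeasure Q]

theorem integrableOn_stoppedValue (hB : Martingale B 𝓕 Q) (hc : ∀ ω, Continuous (B · ω))
    (hσ : IsStoppingTime 𝓕 σ) (hle : σ ≤ τ) (hfin : ∀ᵐ ω ∂Q, τ ω ≠ ⊤) {A : Set Ω}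
    (hA : MeasurableSet A) {c : ℝ} (hb : ∀ ω ∈ A, ∀ t : ℝ≥0, t ≤ τ ω → |B t ω| ≤ c) :
    IntegrableOn (stoppedValue B σ) A Q := by
  refine Measure.integrableOn_of_bounded (M := c) (measure_ne_top _ _)
    ((hB.measurable_stoppedValue_of_continuous hc hσ).mono
      hσ.measurableSpace_le le_rfl).aestronglyMeasurable ?_
  rw [ae_restrict_iff' hA]
  filter_upwards [hfin] with ω hω hωA
  refine hb ω hωA _ ?_
  rw [WithTop.coe_untopA_of_ne_top (ne_top_of_le_ne_top hω (hle ω))]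
  exact hle ω

/-- Jensen's inequality for `y ↦ (y - a)⁺` between two stopping times, with its equality case. -/
theorem setIntegral_max_sub (hB : Martingale B 𝓕 Q) (hc : ∀ ω, Continuous (B · ω))
    (hσ : IsStoppingTime 𝓕 σ) (hτ : IsStoppingTime 𝓕 τ) (hle : σ ≤ τ)
    (hfin : ∀ᵐ ω ∂Q, τ ω ≠ ⊤) {A : Set Ω} (hA : MeasurableSet[𝓕 0] A) {c : ℝ}
    (hb : ∀ ω ∈ A, ∀ t : ℝ≥0, t ≤ τ ω → |B t ω| ≤ c) (a : ℝ) :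
    ∫ ω in A, max (stoppedValue B σ ω - a) 0 ∂Q ≤ ∫ ω in A, max (stoppedValue B τ ω - a) 0 ∂Q ∧
      (∫ ω in A, max (stoppedValue B τ ω - a) 0 ∂Q ≤
          ∫ ω in A, max (stoppedValue B σ ω - a) 0 ∂Q →
        ∀ᵐ ω ∂Q, ω ∈ A → (a ≤ stoppedValue B σ ω → a ≤ stoppedValue B τ ω) ∧
          (stoppedValue B σ ω < a → stoppedValue B τ ω ≤ a)) := by
  have hAm := 𝓕.le 0 _ hA
  set F := stoppedValue B σ with hF
  set G := stoppedValue B τ with hG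
  have hE : MeasurableSet[hσ.measurableSpace] {ω | a ≤ F ω} :=
    hB.measurable_stoppedValue_of_continuous hc hσ measurableSet_Ici
  have hEm : MeasurableSet {ω | a ≤ F ω} := hσ.measurableSpace_le _ hE
  have hFi : IntegrableOn F A Q := hB.integrableOn_stoppedValue hc hσ hle hfin hAm hb
  have hGi : IntegrableOn G A Q := hB.integrableOn_stoppedValue hc hτ le_rfl hfin hAm hb
  have hca : IntegrableOn (fun _ ↦ a) A Q := integrable_const a
  have hos := hB.setIntegral_stoppedValue_eq hc hσ hτ hle hfin hA hb hE
  -- `D` is the pointwise Jensen defect. It is nonnegative, and optional stopping on `{a ≤ F}`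
  -- identifies its integral with the gap between the two sides; if it vanishes, `G` cannot cross
  -- the level `a`.
  set D : Ω → ℝ := fun ω ↦ max (G ω - a) 0 - {ω | a ≤ F ω}.indicator (fun ω ↦ G ω - a) ω with hD
  have hD0 : ∀ ω, 0 ≤ D ω := by
    intro ω
    simp only [hD, indicator]
    split_ifs <;> simp
  have hi1 : IntegrableOn (fun ω ↦ max (G ω - a) 0) A Q := (hGi.sub hca).pos_part
  have hi2 : IntegrableOn ({ω | a ≤ F ω}.indicator fun ω ↦ G ω - a) A Q :=
    (hGi.sub hca).indicator hEm
  have hmax : ∀ ω, max (F ω - a) 0 = {ω | a ≤ F ω}.indicator (fun ω ↦ F ω - a) ω := by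
    intro ω
    by_cases h : a ≤ F ω
    · rw [indicator_of_mem (show ω ∈ {ω | a ≤ F ω} from h), max_eq_left (sub_nonneg.2 h)]
    · rw [indicator_of_notMem (show ω ∉ {ω | a ≤ F ω} from h),
        max_eq_right (sub_nonpos.2 (not_le.1 h).le)]
  have hDint : ∫ ω in A, D ω ∂Q =
      ∫ ω in A, max (G ω - a) 0 ∂Q - ∫ ω in A, max (F ω - a) 0 ∂Q := by
    rw [hD, integral_sub hi1 hi2]
    congr 1
    simp_rw [hmax]
    rw [setIntegral_indicator hEm, setIntegral_indicator hEm,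
      integral_sub (hGi.mono_set inter_subset_left) (hca.mono_set inter_subset_left),
      integral_sub (hFi.mono_set inter_subset_left) (hca.mono_set inter_subset_left), hos]
  refine ⟨sub_nonneg.1 (hDint ▸ integral_nonneg hD0), fun h ↦ ?_⟩
  have hz : ∫ ω in A, D ω ∂Q = 0 :=
    le_antisymm (hDint ▸ sub_nonpos.2 h) (integral_nonneg hD0)
  have hae := (integral_eq_zero_iff_of_nonneg hD0 (hi1.sub hi2)).1 hz
  rw [Filter.EventuallyEq, ae_restrict_iff' hAm] at hae
  filter_upwards [hae] with ω hω hωA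
  have h0 : max (G ω - a) 0 - {ω | a ≤ F ω}.indicator (fun ω ↦ G ω - a) ω = 0 := hω hωA
  refine ⟨fun h ↦ ?_, fun h ↦ ?_⟩
  · rw [indicator_of_mem (show ω ∈ {ω | a ≤ F ω} from h)] at h0
    have := le_max_right (G ω - a) 0
    linarith
  · rw [indicator_of_notMem (show ω ∉ {ω | a ≤ F ω} from h.not_ge)] at h0
    have := le_max_left (G ω - a) 0
    linarith

/-- If a continuous martingale has the same integrable law at two stopping times `σ ≤ τ` and is
bounded up to `τ` on each of the events `A n` known at time `0` which exhaust the space, then it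
takes the same value at all stopping times between `σ` and `τ`. -/
theorem stoppedValue_ae_eq_of_map_eq (hB : Martingale B 𝓕 Q) (hc : ∀ ω, Continuous (B · ω))
    (hσ : IsStoppingTime 𝓕 σ) (hτ : IsStoppingTime 𝓕 τ) (hle : σ ≤ τ)
    (hfin : ∀ᵐ ω ∂Q, τ ω ≠ ⊤) {A : ℕ → Set Ω} (hA : ∀ n, MeasurableSet[𝓕 0] (A n))
    (hmono : Monotone A) (hex : ∀ᵐ ω ∂Q, ∃ n, ω ∈ A n) {c : ℕ → ℝ}
    (hb : ∀ n, ∀ ω ∈ A n, ∀ t : ℝ≥0, t ≤ τ ω → |B t ω| ≤ c n)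
    (hint : Integrable (stoppedValue B τ) Q)
    (hlaw : Q.map (stoppedValue B σ) = Q.map (stoppedValue B τ))
    {ρ : Ω → WithTop ℝ≥0} (hρ : IsStoppingTime 𝓕 ρ) (hσρ : σ ≤ ρ) (hρτ : ρ ≤ τ) :
    stoppedValue B ρ =ᵐ[Q] stoppedValue B σ := by
  have hFm : Measurable (stoppedValue B σ) :=
    (hB.measurable_stoppedValue_of_continuous hc hσ).mono hσ.measurableSpace_le le_rfl
  have hGm : Measurable (stoppedValue B τ) :=
    (hB.measurable_stoppedValue_of_continuous hc hτ).mono hτ.measurableSpace_le le_rfl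
  have hint' : Integrable (stoppedValue B σ) Q := by
    have h1 : Integrable id (Q.map (stoppedValue B τ)) :=
      (integrable_map_measure aestronglyMeasurable_id hGm.aemeasurable).2 hint
    rw [← hlaw] at h1
    exact (integrable_map_measure aestronglyMeasurable_id hFm.aemeasurable).1 h1
  have hAm : ∀ n, MeasurableSet (A n) := fun n ↦ 𝓕.le 0 _ (hA n)
  have hfinρ : ∀ᵐ ω ∂Q, ρ ω ≠ ⊤ := hfin.mono fun ω h ↦ ne_top_of_le_ne_top h (hρτ ω)
  have hbρ : ∀ n, ∀ ω ∈ A n, ∀ t : ℝ≥0, t ≤ ρ ω → |B t ω| ≤ c n :=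
    fun n ω hω t ht ↦ hb n ω hω t (ht.trans (hρτ ω))
  have huniv : (⋃ n, A n) =ᵐ[Q] (univ : Set Ω) := by
    rw [eventuallyEq_univ]
    exact hex.mono fun ω h ↦ mem_iUnion.2 h
  -- Equality of laws only gives a zero total gap. Since `A m \ A n` is also known at time `0`,
  -- Jensen makes its contribution nonnegative, so the gap over `A n` is at most the gap over `A m`,
  -- which tends to `0`.
  have key : ∀ (a : ℝ) (n : ℕ), ∫ ω in A n, max (stoppedValue B τ ω - a) 0 ∂Q ≤
      ∫ ω in A n, max (stoppedValue B σ ω - a) 0 ∂Q := by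
    intro a n
    have hiG : Integrable (fun ω ↦ max (stoppedValue B τ ω - a) 0) Q :=
      (hint.sub (integrable_const a)).pos_part
    have hiF : Integrable (fun ω ↦ max (stoppedValue B σ ω - a) 0) Q :=
      (hint'.sub (integrable_const a)).pos_part
    set D : Ω → ℝ := fun ω ↦ max (stoppedValue B τ ω - a) 0 - max (stoppedValue B σ ω - a) 0
    have hiD : Integrable D Q := hiG.sub hiF
    have hD0 : ∫ ω, D ω ∂Q = 0 := by
      rw [integral_sub hiG hiF, sub_eq_zero]
      have hφ : Measurable fun y : ℝ ↦ max (y - a) 0 := by fun_prop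
      have e1 := integral_map (μ := Q) hGm.aemeasurable hφ.aestronglyMeasurable
      have e2 := integral_map (μ := Q) hFm.aemeasurable hφ.aestronglyMeasurable
      rw [← e1, ← e2, hlaw]
    have hlim : Tendsto (fun m ↦ ∫ ω in A m, D ω ∂Q) atTop (𝓝 0) := by
      have := tendsto_setIntegral_of_monotone hAm hmono hiD.integrableOn
      rwa [setIntegral_congr_set huniv, setIntegral_univ, hD0] at this
    have hDn : ∫ ω in A n, D ω ∂Q ≤ 0 := by
      refine ge_of_tendsto hlim ?_
      filter_upwards [eventually_ge_atTop n] with m hm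
      have hsplit : ∫ ω in A m, D ω ∂Q = ∫ ω in A m \ A n, D ω ∂Q + ∫ ω in A n, D ω ∂Q := by
        rw [← setIntegral_union disjoint_sdiff_left (hAm n) hiD.integrableOn hiD.integrableOn,
          sdiff_union_of_subset (hmono hm)]
      have hnn : 0 ≤ ∫ ω in A m \ A n, D ω ∂Q := by
        rw [integral_sub hiG.integrableOn hiF.integrableOn, sub_nonneg]
        exact (hB.setIntegral_max_sub hc hσ hτ hle hfin ((hA m).diff (hA n))
          (fun ω hω ↦ hb m ω hω.1) a).1
      linarith
    rwa [integral_sub hiG.integrableOn hiF.integrableOn, sub_nonpos] at hDn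
  have hae : ∀ᵐ ω ∂Q, ∀ (n : ℕ) (a : ℚ), ω ∈ A n →
      ((a : ℝ) ≤ stoppedValue B σ ω → (a : ℝ) ≤ stoppedValue B ρ ω) ∧
        (stoppedValue B σ ω < a → stoppedValue B ρ ω ≤ a) := by
    simp only [ae_all_iff]
    intro n a
    refine (hB.setIntegral_max_sub hc hσ hρ hσρ hfinρ (hA n) (hbρ n) a).2 ?_
    exact ((hB.setIntegral_max_sub hc hρ hτ hρτ hfin (hA n) (hb n) a).1).trans (key a n)
  -- Two reals that no rational separates are equal.
  filter_upwards [hex, hae] with ω ⟨n, hn⟩ h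
  refine le_antisymm ?_ ?_
  · exact le_of_forall_lt_rat_imp_le fun a ha ↦ (h n a hn).2 ha
  · exact le_of_forall_rat_lt_imp_le fun a ha ↦ (h n a hn).1 ha.le

end MeasureTheory.Martingale

/-! ### Barrier time, boundary time and exit time -/

/-- The distance of `B_t` to the nearer end point of `[T_d(B_0), T_u(B_0)]`, negative outside. -/
def boundaryGap {Ω : Type*} (B : ℝ≥0 → Ω → ℝ) (Td Tu : ℝ → ℝ) (t : ℝ≥0) (ω : Ω) : ℝ :=
  min (Tu (B 0 ω) - B t ω) (B t ω - Td (B 0 ω))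

/-- The time at which `B` reaches the boundary of `[T_d(B_0), T_u(B_0)]`. -/
noncomputable def boundaryTime {Ω : Type*} (B : ℝ≥0 → Ω → ℝ) (Td Tu : ℝ → ℝ) : Ω → WithTop ℝ≥0 :=
  hittingAfter (boundaryGap B Td Tu) (Iic 0) 0

theorem le_hittingAfter_of_forall {Ω β : Type*} {u : ℝ≥0 → Ω → β} {s : Set β} {n : ℝ≥0} {ω : Ω}
    {T : WithTop ℝ≥0} (h : ∀ j, n ≤ j → u j ω ∈ s → T ≤ j) : T ≤ hittingAfter u s n ω := by
  by_cases hex : ∃ j, n ≤ j ∧ u j ω ∈ s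
  · rw [hittingAfter, if_pos hex]
    obtain ⟨j, hj⟩ := hex
    obtain ⟨t, rfl⟩ := WithTop.ne_top_iff_exists.1
      (ne_top_of_le_ne_top WithTop.coe_ne_top (h j hj.1 hj.2))
    exact WithTop.coe_le_coe.2 (le_csInf ⟨j, hj⟩ fun b hb ↦ WithTop.coe_le_coe.1 (h b hb.1 hb.2))
  · rw [hittingAfter, if_neg hex]
    exact le_top

theorem planExitTime_eq_firstNegTime {Ω : Type*} (B : ℝ≥0 → Ω → ℝ) (Td Tu : ℝ → ℝ) :
    planExitTime B Td Tu = fun ω ↦ firstNegTime (boundaryGap B Td Tu · ω) := by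
  funext ω
  rw [planExitTime, firstNegTime]
  congr 3
  ext t
  simp only [boundaryGap, mem_Icc, min_lt_iff, sub_neg, not_and_or, not_le, or_comm]

namespace IsMonotonePair

section Deterministic

variable {μ : Measure ℝ} {P : Measure (ℝ × ℝ)} {S : Set ℝ} {Td Tu : ℝ → ℝ}

/-- If the half-line hit starts at `T w - w` and has height `y = T w`, then `T w - w ≤ y - x` says
exactly `x ≤ w`. Monotonicity of `Tu`, or the no-crossing property of `Td`, then keeps `y` out of
the open interval of `x`. -/
theorem min_le_zero_of_mem_barrier (h : IsMonotonePair μ P S Td Tu) {x y : ℝ} (hx : x ∈ S)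
    (hxy : (y - x, y) ∈ monotoneBarrier S Td Tu) : min (Tu x - y) (y - Td x) ≤ 0 := by
  by_contra! hpos
  obtain ⟨h1, h2⟩ := lt_min_iff.1 hpos
  simp only [monotoneBarrier, barrierPart, mem_union, mem_iUnion, mem_prod, mem_Ici,
    mem_singleton_iff, exists_prop] at hxy
  rcases hxy with ⟨w, hw, hwx, rfl⟩ | ⟨w, hw, hwx, rfl⟩
  · linarith [h.monotone_up x hx w hw (by linarith)]
  · rcases (show x ≤ w by linarith).eq_or_lt with rfl | hlt
    · linarith
    · exact h.down_notMem x hx w hw hlt ⟨by linarith, by linarith⟩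

theorem mem_barrier_of_min_eq_zero {x y : ℝ} (hx : x ∈ S)
    (hxy : min (Tu x - y) (y - Td x) = 0) : (y - x, y) ∈ monotoneBarrier S Td Tu := by
  simp only [monotoneBarrier, barrierPart, mem_union, mem_iUnion, mem_prod, mem_Ici,
    mem_singleton_iff, exists_prop]
  rcases min_choice (Tu x - y) (y - Td x) with h | h
  · exact .inl ⟨x, hx, by linarith, by linarith⟩
  · exact .inr ⟨x, hx, by linarith, by linarith⟩

theorem upWeight_mem_Icc (h : IsMonotonePair μ P S Td Tu) {x : ℝ} (hx : x ∈ S) :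
    upWeight Td Tu x ∈ Icc 0 1 := by
  have h1 := h.down_le x hx
  have h2 := h.le_up x hx
  rw [upWeight]
  split_ifs with hlt
  · exact ⟨div_nonneg (by linarith) (by linarith), (div_le_one (by linarith)).2 (by linarith)⟩
  · simp

variable {Ω : Type*} {B : ℝ≥0 → Ω → ℝ} {ω : Ω}

theorem continuous_boundaryGap (hc : Continuous (B · ω)) :
    Continuous (boundaryGap B Td Tu · ω) := by
  unfold boundaryGap; fun_prop

theorem boundaryGap_zero_nonneg (h : IsMonotonePair μ P S Td Tu) (hω : B 0 ω ∈ S) :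
    0 ≤ boundaryGap B Td Tu 0 ω :=
  le_min (sub_nonneg.2 (h.le_up _ hω)) (sub_nonneg.2 (h.down_le _ hω))

theorem barrierTime_eq_boundaryTime (h : IsMonotonePair μ P S Td Tu) (hω : B 0 ω ∈ S)
    (hc : Continuous (B · ω)) :
    barrierTime B (monotoneBarrier S Td Tu) ω = boundaryTime B Td Tu ω := by
  refine le_antisymm ?_ (le_hittingAfter_of_forall fun j hj hmem ↦
    hittingAfter_le_of_mem hj (h.min_le_zero_of_mem_barrier hω hmem))
  by_cases htop : boundaryTime B Td Tu ω = ⊤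
  · rw [htop]; exact le_top
  obtain ⟨t, ht⟩ := WithTop.ne_top_iff_exists.1 htop
  rw [← ht]
  refine hittingAfter_le_of_mem zero_le (mem_barrier_of_min_eq_zero hω (le_antisymm ?_ ?_))
  · exact apply_hittingAfter_Iic (continuous_boundaryGap hc) ht.symm
  · exact nonneg_of_le_hittingAfter_Iic (continuous_boundaryGap hc) (h.boundaryGap_zero_nonneg hω)
      ht.le

theorem stoppedValue_boundaryTime (h : IsMonotonePair μ P S Td Tu) (hω : B 0 ω ∈ S)
    (hc : Continuous (B · ω)) (htop : boundaryTime B Td Tu ω ≠ ⊤) :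
    stoppedValue B (boundaryTime B Td Tu) ω = Tu (B 0 ω) ∨
      stoppedValue B (boundaryTime B Td Tu) ω = Td (B 0 ω) := by
  have ht := WithTop.coe_untopA_of_ne_top htop
  have hz : boundaryGap B Td Tu (boundaryTime B Td Tu ω).untopA ω = 0 := le_antisymm
    (apply_hittingAfter_Iic (continuous_boundaryGap hc) ht.symm)
    (nonneg_of_le_hittingAfter_Iic (continuous_boundaryGap hc) (h.boundaryGap_zero_nonneg hω) ht.le)
  rw [boundaryGap] at hz
  rw [stoppedValue]
  rcases min_choice (Tu (B 0 ω) - B (boundaryTime B Td Tu ω).untopA ω)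
    (B (boundaryTime B Td Tu ω).untopA ω - Td (B 0 ω)) with h | h
  · exact .inl (by linarith)
  · exact .inr (by linarith)

theorem mem_Icc_of_le_planExitTime (h : IsMonotonePair μ P S Td Tu) (hω : B 0 ω ∈ S)
    (hc : Continuous (B · ω)) {t : ℝ≥0} (ht : t ≤ planExitTime B Td Tu ω) :
    B t ω ∈ Icc (Td (B 0 ω)) (Tu (B 0 ω)) := by
  rw [planExitTime_eq_firstNegTime] at ht
  have := le_min_iff.1 (nonneg_of_le_firstNegTime (continuous_boundaryGap hc)
    (h.boundaryGap_zero_nonneg hω) ht)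
  exact ⟨sub_nonneg.1 this.2, sub_nonneg.1 this.1⟩

theorem boundaryTime_le_planExitTime : boundaryTime B Td Tu ≤ planExitTime B Td Tu := by
  rw [planExitTime_eq_firstNegTime]
  exact fun ω ↦ hittingAfter_Iic_le_firstNegTime

end Deterministic

/-- The event that `B_0` lies in `S` and the interval `[T_d(B_0), T_u(B_0)]` is within `[-n, n]`. -/
def boundedEvent {Ω : Type*} (B : ℝ≥0 → Ω → ℝ) (S : Set ℝ) (Td Tu : ℝ → ℝ) (n : ℕ) : Set Ω :=
  {ω | B 0 ω ∈ S ∧ |Td (B 0 ω)| ≤ n ∧ |Tu (B 0 ω)| ≤ n}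

variable {μ : Measure ℝ} {P : Measure (ℝ × ℝ)} {S : Set ℝ} {Td Tu : ℝ → ℝ}
  {Ω : Type*} {mΩ : MeasurableSpace Ω} {Q : Measure Ω}
  {𝓕 : Filtration ℝ≥0 mΩ} {B : ℝ≥0 → Ω → ℝ}

theorem monotone_boundedEvent : Monotone (boundedEvent B S Td Tu) := fun m n hmn _ hω ↦
  have h : (m : ℝ) ≤ n := Nat.cast_le.2 hmn
  ⟨hω.1, hω.2.1.trans h, hω.2.2.trans h⟩

theorem exists_mem_boundedEvent {ω : Ω} (hω : B 0 ω ∈ S) : ∃ n, ω ∈ boundedEvent B S Td Tu n := by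
  obtain ⟨n, hn⟩ := exists_nat_ge (max |Td (B 0 ω)| |Tu (B 0 ω)|)
  exact ⟨n, hω, (le_max_left _ _).trans hn, (le_max_right _ _).trans hn⟩

theorem measurableSet_boundedEvent (h : IsMonotonePair μ P S Td Tu) (hB : Adapted 𝓕 B) (n : ℕ) :
    MeasurableSet[𝓕 0] (boundedEvent B S Td Tu n) := by
  have h1 : MeasurableSet {x | x ∈ S ∧ |Td x| ≤ n ∧ |Tu x| ≤ n} :=
    h.measurableSet.inter ((measurableSet_le h.measurable_down.abs measurable_const).inter
      (measurableSet_le h.measurable_up.abs measurable_const))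
  exact hB 0 h1

theorem abs_le_of_mem_boundedEvent (h : IsMonotonePair μ P S Td Tu)
    (hc : ∀ ω, Continuous (B · ω)) {n : ℕ} {ω : Ω} (hω : ω ∈ boundedEvent B S Td Tu n) {t : ℝ≥0}
    (ht : t ≤ planExitTime B Td Tu ω) : |B t ω| ≤ n := by
  have hm := h.mem_Icc_of_le_planExitTime hω.1 (hc ω) ht
  have h1 := abs_le.1 hω.2.1
  have h2 := abs_le.1 hω.2.2
  exact abs_le.2 ⟨by linarith [hm.1], by linarith [hm.2]⟩

theorem ae_mem (h : IsMonotonePair μ P S Td Tu) (hB0 : HasLaw (B 0) μ Q) : ∀ᵐ ω ∂Q, B 0 ω ∈ S := by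
  have h1 : ∀ᵐ x ∂μ, x ∈ S := h.measure_compl
  rw [← hB0.map_eq] at h1
  exact ae_of_ae_map hB0.aemeasurable h1

/-- A path that never leaves an interval within `[-n, n]` has `|B m - B 0| ≤ 2n` for every `m`, an
event whose probability tends to `0`. -/
theorem planExitTime_ne_top (h : IsMonotonePair μ P S Td Tu) (hc : ∀ ω, Continuous (B · ω))
    (hB0 : HasLaw (B 0) μ Q)
    (hspread : ∀ c : ℝ, Tendsto (fun n : ℕ ↦ Q {ω | |B n ω - B 0 ω| ≤ c}) atTop (𝓝 0)) :
    ∀ᵐ ω ∂Q, planExitTime B Td Tu ω ≠ ⊤ := by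
  have h1 : ∀ᵐ ω ∂Q, ∀ n : ℕ, ω ∉ boundedEvent B S Td Tu n ∩ {ω | planExitTime B Td Tu ω = ⊤} := by
    rw [ae_all_iff]
    intro n
    rw [← measure_eq_zero_iff_ae_notMem]
    refine le_antisymm (ge_of_tendsto' (hspread (n + n)) fun m ↦ measure_mono ?_) zero_le
    rintro ω ⟨hω, htop : _ = ⊤⟩
    have hb : ∀ t : ℝ≥0, |B t ω| ≤ n := fun t ↦
      h.abs_le_of_mem_boundedEvent hc hω (htop ▸ le_top)
    exact (abs_sub _ _).trans (add_le_add (hb _) (hb _))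
  filter_upwards [h1, h.ae_mem hB0] with ω hω hS htop
  obtain ⟨n, hn⟩ := exists_mem_boundedEvent (Td := Td) (Tu := Tu) hS
  exact hω n ⟨hn, htop⟩

theorem adapted_boundaryGap (h : IsMonotonePair μ P S Td Tu) (hB : Adapted 𝓕 B) :
    Adapted 𝓕 (boundaryGap B Td Tu) := by
  intro t
  have h0 : Measurable[𝓕 t] (B 0) := (hB 0).mono (𝓕.mono zero_le) le_rfl
  exact ((h.measurable_up.comp h0).sub (hB t)).min ((hB t).sub (h.measurable_down.comp h0))

theorem isStoppingTime_boundaryTime (h : IsMonotonePair μ P S Td Tu) (hB : Adapted 𝓕 B)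
    (hc : ∀ ω, Continuous (B · ω)) : IsStoppingTime 𝓕 (boundaryTime B Td Tu) :=
  isStoppingTime_hittingAfter_Iic (h.adapted_boundaryGap hB) fun ω ↦ continuous_boundaryGap (hc ω)

theorem isStoppingTime_planExitTime [𝓕.IsRightContinuous] (h : IsMonotonePair μ P S Td Tu)
    (hB : Adapted 𝓕 B) (hc : ∀ ω, Continuous (B · ω)) :
    IsStoppingTime 𝓕 (planExitTime B Td Tu) := by
  rw [planExitTime_eq_firstNegTime]
  exact isStoppingTime_firstNegTime (h.adapted_boundaryGap hB)
    fun ω ↦ continuous_boundaryGap (hc ω)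

variable [IsProbabilityMeasure Q]

theorem boundaryTime_ae_eq_planExitTime [𝓕.IsRightContinuous] (h : IsMonotonePair μ P S Td Tu)
    (hB : Martingale B 𝓕 Q) (hc : ∀ ω, Continuous (B · ω)) (hB0 : HasLaw (B 0) μ Q)
    (hinc : ∀ p r : ℝ≥0, p ≠ r → ∀ᵐ ω ∂Q, B p ω ≠ B r ω)
    (hfin : ∀ᵐ ω ∂Q, planExitTime B Td Tu ω ≠ ⊤) :
    boundaryTime B Td Tu =ᵐ[Q] planExitTime B Td Tu := by
  have hBa : Adapted 𝓕 B := hB.stronglyAdapted.adapted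
  have hσ := h.isStoppingTime_boundaryTime hBa hc
  refine ae_eq_of_forall_stoppedValue_ae_eq hinc hσ (h.isStoppingTime_planExitTime hBa hc)
    boundaryTime_le_planExitTime fun ρ hρ hσρ hρτ ↦ ?_
  have hfinρ : ∀ᵐ ω ∂Q, ρ ω ≠ ⊤ := hfin.mono fun ω hω ↦ ne_top_of_le_ne_top hω (hρτ ω)
  have hBσ := hB.measurable_stoppedValue_of_continuous hc hσ
  have hB0σ : Measurable[hσ.measurableSpace] (B 0) :=
    (hBa 0).mono (hσ.le_measurableSpace_of_const_le fun _ ↦ bot_le) le_rfl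
  -- Two variables with equal integrals, one dominating the other, agree almost everywhere. At the
  -- upper end point `B` can only have moved down by time `ρ`, at the lower one only up.
  have key : ∀ (n : ℕ) (E : Set Ω), MeasurableSet[hσ.measurableSpace] E →
      ((∀ᵐ ω ∂Q, ω ∈ boundedEvent B S Td Tu n ∩ E →
          stoppedValue B ρ ω ≤ stoppedValue B (boundaryTime B Td Tu) ω) ∨
        (∀ᵐ ω ∂Q, ω ∈ boundedEvent B S Td Tu n ∩ E →
          stoppedValue B (boundaryTime B Td Tu) ω ≤ stoppedValue B ρ ω)) →
      ∀ᵐ ω ∂Q, ω ∈ boundedEvent B S Td Tu n ∩ E →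
        stoppedValue B ρ ω = stoppedValue B (boundaryTime B Td Tu) ω := by
    intro n E hE hor
    have hA := h.measurableSet_boundedEvent hBa n
    have hb : ∀ ω ∈ boundedEvent B S Td Tu n, ∀ t : ℝ≥0, t ≤ ρ ω → |B t ω| ≤ n :=
      fun ω hω t ht ↦ h.abs_le_of_mem_boundedEvent hc hω (ht.trans (hρτ ω))
    have hm : MeasurableSet (boundedEvent B S Td Tu n ∩ E) :=
      (𝓕.le 0 _ hA).inter (hσ.measurableSpace_le _ hE)
    have hi1 := (hB.integrableOn_stoppedValue hc hσ hσρ hfinρ (𝓕.le 0 _ hA) hb).mono_set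
      (inter_subset_left (t := E))
    have hi2 := (hB.integrableOn_stoppedValue hc hρ le_rfl hfinρ (𝓕.le 0 _ hA) hb).mono_set
      (inter_subset_left (t := E))
    have hos := hB.setIntegral_stoppedValue_eq hc hσ hρ hσρ hfinρ hA hb hE
    simp_rw [← ae_restrict_iff' hm] at hor ⊢
    rcases hor with hor | hor
    · exact (integral_eq_iff_of_ae_le hi2 hi1 hor).1 hos.symm
    · exact ((integral_eq_iff_of_ae_le hi1 hi2 hor).1 hos).symm
  have hIcc : ∀ᵐ ω ∂Q, ∀ n, ω ∈ boundedEvent B S Td Tu n →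
      stoppedValue B ρ ω ∈ Icc (Td (B 0 ω)) (Tu (B 0 ω)) := by
    filter_upwards [hfinρ] with ω hω n hn
    refine h.mem_Icc_of_le_planExitTime hn.1 (hc ω) ?_
    rw [WithTop.coe_untopA_of_ne_top hω]
    exact hρτ ω
  have hu : ∀ᵐ ω ∂Q, ∀ n, ω ∈ boundedEvent B S Td Tu n ∩
      {ω | stoppedValue B (boundaryTime B Td Tu) ω = Tu (B 0 ω)} →
        stoppedValue B ρ ω = stoppedValue B (boundaryTime B Td Tu) ω := by
    refine ae_all_iff.2 fun n ↦ key n _ (measurableSet_eq_fun hBσ (h.measurable_up.comp hB0σ))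
      (.inl ?_)
    filter_upwards [hIcc] with ω hω ⟨hn, heq⟩
    rw [heq]
    exact (hω n hn).2
  have hd : ∀ᵐ ω ∂Q, ∀ n, ω ∈ boundedEvent B S Td Tu n ∩
      {ω | stoppedValue B (boundaryTime B Td Tu) ω = Td (B 0 ω)} →
        stoppedValue B ρ ω = stoppedValue B (boundaryTime B Td Tu) ω := by
    refine ae_all_iff.2 fun n ↦ key n _ (measurableSet_eq_fun hBσ (h.measurable_down.comp hB0σ))
      (.inr ?_)
    filter_upwards [hIcc] with ω hω ⟨hn, heq⟩
    rw [heq]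
    exact (hω n hn).1
  filter_upwards [hu, hd, hfinρ, h.ae_mem hB0] with ω hu hd hω hS
  obtain ⟨n, hn⟩ := exists_mem_boundedEvent (Td := Td) (Tu := Tu) hS
  rcases h.stoppedValue_boundaryTime hS (hc ω) (ne_top_of_le_ne_top hω (hσρ ω)) with heq | heq
  · exact hu n ⟨hn, heq⟩
  · exact hd n ⟨hn, heq⟩

end IsMonotonePair

/-! ### Joint law of the initial and the stopped value -/

namespace IsMonotonePair

variable {μ : Measure ℝ} {P : Measure (ℝ × ℝ)} {S : Set ℝ} {Td Tu : ℝ → ℝ}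
  {Ω : Type*} {mΩ : MeasurableSpace Ω} {Q : Measure Ω} [IsProbabilityMeasure Q]
  {𝓕 : Filtration ℝ≥0 mΩ} {B : ℝ≥0 → Ω → ℝ} {τ : Ω → WithTop ℝ≥0}

/-- The conditional probability given `𝓕 0` that a continuous martingale stopped at the boundary of
`[T_d(B_0), T_u(B_0)]` ends up at the upper end point. -/
theorem condExp_indicator_up (h : IsMonotonePair μ P S Td Tu) (hB : Martingale B 𝓕 Q)
    (hc : ∀ ω, Continuous (B · ω)) (hB0 : HasLaw (B 0) μ Q) (hτ : IsStoppingTime 𝓕 τ)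
    (hle : τ ≤ planExitTime B Td Tu) (hfin : ∀ᵐ ω ∂Q, τ ω ≠ ⊤)
    (hval : ∀ᵐ ω ∂Q, stoppedValue B τ ω = Tu (B 0 ω) ∨ stoppedValue B τ ω = Td (B 0 ω)) :
    Q[{ω | stoppedValue B τ ω = Tu (B 0 ω) ∧ Td (B 0 ω) < Tu (B 0 ω)}.indicator
      (fun _ ↦ (1 : ℝ)) | 𝓕 0] =ᵐ[Q] fun ω ↦ upWeight Td Tu (B 0 ω) := by
  have hBa : Adapted 𝓕 B := hB.stronglyAdapted.adapted
  have hBτ : Measurable (stoppedValue B τ) :=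
    (hB.measurable_stoppedValue_of_continuous hc hτ).mono hτ.measurableSpace_le le_rfl
  have hum : Measurable[𝓕 0] fun ω ↦ Tu (B 0 ω) := h.measurable_up.comp (hBa 0)
  have hdm : Measurable[𝓕 0] fun ω ↦ Td (B 0 ω) := h.measurable_down.comp (hBa 0)
  have hum' : Measurable fun ω ↦ Tu (B 0 ω) := hum.mono (𝓕.le 0) le_rfl
  have hdm' : Measurable fun ω ↦ Td (B 0 ω) := hdm.mono (𝓕.le 0) le_rfl
  set N : Set Ω := {ω | Td (B 0 ω) < Tu (B 0 ω)} with hN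
  have hNm : MeasurableSet[𝓕 0] N := measurableSet_lt hdm hum
  -- The strict inequality empties `U` where the interval degenerates, matching the value `0` of
  -- `upWeight` there.
  set U : Set Ω := {ω | stoppedValue B τ ω = Tu (B 0 ω) ∧ Td (B 0 ω) < Tu (B 0 ω)} with hU
  have hUm : MeasurableSet U := (measurableSet_eq_fun hBτ hum').inter (𝓕.le 0 _ hNm)
  have hUi : Integrable (U.indicator fun _ ↦ (1 : ℝ)) Q := (integrable_const 1).indicator hUm
  have hoff : Q[U.indicator (fun _ ↦ (1 : ℝ)) | 𝓕 0] =ᵐ[Q]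
      N.indicator (Q[U.indicator (fun _ ↦ (1 : ℝ)) | 𝓕 0]) := by
    have := condExp_indicator (m := 𝓕 0) hUi hNm
    rwa [indicator_indicator, inter_eq_right.2 (fun ω hω ↦ hω.2)] at this
  have hon : ∀ n, ∀ᵐ ω ∂Q, ω ∈ boundedEvent B S Td Tu n →
      (Tu (B 0 ω) - Td (B 0 ω)) * (Q[U.indicator (fun _ ↦ (1 : ℝ)) | 𝓕 0]) ω =
        B 0 ω - Td (B 0 ω) := by
    intro n
    set A := boundedEvent B S Td Tu n
    have hA : MeasurableSet[𝓕 0] A := h.measurableSet_boundedEvent hBa n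
    have hb : ∀ ω ∈ A, ∀ t : ℝ≥0, t ≤ τ ω → |B t ω| ≤ n :=
      fun ω hω t ht ↦ h.abs_le_of_mem_boundedEvent hc hω (ht.trans (hle ω))
    set g : Ω → ℝ := A.indicator fun ω ↦ Tu (B 0 ω) - Td (B 0 ω) with hg
    have hgm : StronglyMeasurable[𝓕 0] g :=
      (((hum.sub hdm).indicator hA : Measurable[𝓕 0] g)).stronglyMeasurable
    have hAd : IntegrableOn (fun ω ↦ Td (B 0 ω)) A Q :=
      Measure.integrableOn_of_bounded (M := n) (measure_ne_top _ _) hdm'.aestronglyMeasurable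
        ((ae_restrict_iff' (𝓕.le 0 _ hA)).2 (ae_of_all _ fun ω hω ↦ hω.2.1))
    have hAu : IntegrableOn (fun ω ↦ Tu (B 0 ω)) A Q :=
      Measure.integrableOn_of_bounded (M := n) (measure_ne_top _ _) hum'.aestronglyMeasurable
        ((ae_restrict_iff' (𝓕.le 0 _ hA)).2 (ae_of_all _ fun ω hω ↦ hω.2.2))
    have hAτ : IntegrableOn (stoppedValue B τ) A Q :=
      hB.integrableOn_stoppedValue hc hτ le_rfl hfin (𝓕.le 0 _ hA) hb
    have hA0 : IntegrableOn (B 0) A Q := (hB.integrable 0).integrableOn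
    -- On `A` the stopped value takes only the two end points, so its height above `Td` is the
    -- interval length times the indicator of `U`. Conditioning on `𝓕 0` pulls out the length and
    -- turns the height into `B 0 - Td (B 0)`.
    have heq : g * U.indicator (fun _ ↦ (1 : ℝ)) =ᵐ[Q]
        A.indicator fun ω ↦ stoppedValue B τ ω - Td (B 0 ω) := by
      filter_upwards [hval] with ω hω
      by_cases hωA : ω ∈ A
      · rw [Pi.mul_apply, hg, indicator_of_mem hωA, indicator_of_mem hωA]
        by_cases hωU : ω ∈ U
        · rw [indicator_of_mem hωU, hωU.1, mul_one]
        · rw [indicator_of_notMem hωU, mul_zero]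
          rcases hω with hω | hω
          · have h1 := h.down_le _ hωA.1
            have h2 := h.le_up _ hωA.1
            have h3 : ¬ Td (B 0 ω) < Tu (B 0 ω) := fun hlt ↦ hωU ⟨hω, hlt⟩
            linarith
          · rw [hω, sub_self]
      · rw [Pi.mul_apply, hg, indicator_of_notMem hωA, indicator_of_notMem hωA, zero_mul]
    have hfi : Integrable (A.indicator fun ω ↦ stoppedValue B τ ω - Td (B 0 ω)) Q :=
      (integrable_indicator_iff (𝓕.le 0 _ hA)).2 (hAτ.sub hAd)
    have hpull := condExp_mul_of_stronglyMeasurable_left hgm (hfi.congr heq.symm) hUi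
    have hexp : A.indicator (fun ω ↦ B 0 ω - Td (B 0 ω)) =ᵐ[Q]
        Q[A.indicator (fun ω ↦ stoppedValue B τ ω - Td (B 0 ω)) | 𝓕 0] := by
      refine ae_eq_condExp_of_forall_setIntegral_eq (𝓕.le 0) hfi
        (fun s _ _ ↦ ((integrable_indicator_iff (𝓕.le 0 _ hA)).2 (hA0.sub hAd)).integrableOn)
        (fun s hs _ ↦ ?_) (((hBa 0).sub hdm).indicator hA).stronglyMeasurable.aestronglyMeasurable
      have h0 := isStoppingTime_const 𝓕 (0 : ℝ≥0)
      have hos := hB.setIntegral_stoppedValue_eq hc h0 hτ (fun ω ↦ bot_le) hfin hA hb (E := s)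
        (by rwa [IsStoppingTime.measurableSpace_const])
      rw [stoppedValue_const] at hos
      rw [setIntegral_indicator (𝓕.le 0 _ hA), setIntegral_indicator (𝓕.le 0 _ hA), inter_comm s A,
        integral_sub (hA0.mono_set inter_subset_left) (hAd.mono_set inter_subset_left),
        integral_sub (hAτ.mono_set inter_subset_left) (hAd.mono_set inter_subset_left), hos]
    filter_upwards [hpull, condExp_congr_ae (m := 𝓕 0) heq, hexp] with ω h1 h2 h3 hωA
    rw [← h3, h1, Pi.mul_apply, hg, indicator_of_mem hωA, indicator_of_mem hωA] at h2
    exact h2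
  filter_upwards [hoff, ae_all_iff.2 hon, h.ae_mem hB0] with ω hoff hon hS
  obtain ⟨n, hn⟩ := exists_mem_boundedEvent (Td := Td) (Tu := Tu) hS
  rw [upWeight]
  split_ifs with hlt
  · rw [eq_div_iff (sub_pos.2 hlt).ne', mul_comm]
    exact hon n hn
  · rw [hoff, indicator_of_notMem (show ω ∉ N from hlt)]

theorem hasLaw_stoppedValue (h : IsMonotonePair μ P S Td Tu) (hB : Martingale B 𝓕 Q)
    (hc : ∀ ω, Continuous (B · ω)) (hB0 : HasLaw (B 0) μ Q) (hτ : IsStoppingTime 𝓕 τ)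
    (hle : τ ≤ planExitTime B Td Tu) (hfin : ∀ᵐ ω ∂Q, τ ω ≠ ⊤)
    (hval : ∀ᵐ ω ∂Q, stoppedValue B τ ω = Tu (B 0 ω) ∨ stoppedValue B τ ω = Td (B 0 ω)) :
    HasLaw (fun ω ↦ (B 0 ω, stoppedValue B τ ω)) P Q := by
  have hBa : Adapted 𝓕 B := hB.stronglyAdapted.adapted
  have hB0m : Measurable (B 0) := (hBa 0).mono (𝓕.le 0) le_rfl
  have hBτ : Measurable (stoppedValue B τ) :=
    (hB.measurable_stoppedValue_of_continuous hc hτ).mono hτ.measurableSpace_le le_rfl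
  have hqm := measurable_upWeight h.measurable_down h.measurable_up
  set U : Set Ω := {ω | stoppedValue B τ ω = Tu (B 0 ω) ∧ Td (B 0 ω) < Tu (B 0 ω)} with hU
  have hUm : MeasurableSet U := (measurableSet_eq_fun hBτ (h.measurable_up.comp hB0m)).inter
    (measurableSet_lt (h.measurable_down.comp hB0m) (h.measurable_up.comp hB0m))
  have hUi : Integrable (U.indicator fun _ ↦ (1 : ℝ)) Q := (integrable_const 1).indicator hUm
  have hcond := h.condExp_indicator_up hB hc hB0 hτ hle hfin hval
  have hqi : Integrable (fun ω ↦ upWeight Td Tu (B 0 ω)) Q := integrable_condExp.congr hcond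
  have hq01 : ∀ᵐ ω ∂Q, upWeight Td Tu (B 0 ω) ∈ Icc 0 1 :=
    (h.ae_mem hB0).mono fun ω hω ↦ h.upWeight_mem_Icc hω
  have hreal : ∀ C, MeasurableSet[𝓕 0] C →
      Q.real (C ∩ U) = ∫ ω in C, upWeight Td Tu (B 0 ω) ∂Q := by
    intro C hC
    rw [← setIntegral_congr_ae (𝓕.le 0 _ hC) (hcond.mono fun ω hω _ ↦ hω),
      setIntegral_condExp (𝓕.le 0) hUi hC, setIntegral_indicator hUm]
    simp
  have hup : ∀ C, MeasurableSet[𝓕 0] C →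
      Q (C ∩ U) = ∫⁻ ω in C, ENNReal.ofReal (upWeight Td Tu (B 0 ω)) ∂Q := by
    intro C hC
    rw [← ofReal_integral_eq_lintegral_ofReal hqi.integrableOn
      (ae_restrict_of_ae (hq01.mono fun ω hω ↦ hω.1)), ← hreal C hC, ofReal_measureReal]
  have hdown : ∀ C, MeasurableSet[𝓕 0] C →
      Q (C \ U) = ∫⁻ ω in C, ENNReal.ofReal (1 - upWeight Td Tu (B 0 ω)) ∂Q := by
    intro C hC
    have hi : Integrable (fun ω ↦ 1 - upWeight Td Tu (B 0 ω)) Q := (integrable_const 1).sub hqi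
    rw [← ofReal_integral_eq_lintegral_ofReal hi.integrableOn
      (ae_restrict_of_ae (hq01.mono fun ω hω ↦ sub_nonneg.2 hω.2)),
      integral_sub (integrable_const 1) hqi.integrableOn, ← hreal C hC, ← ofReal_measureReal]
    congr 1
    have : Q.real (C ∩ U) + Q.real (C \ U) = Q.real C := measureReal_inter_add_sdiff hUm
    simp only [integral_const, MeasurableSet.univ, measureReal_restrict_apply, univ_inter,
      smul_eq_mul, mul_one]
    linarith
  refine ⟨(hB0m.prodMk hBτ).aemeasurable, ?_⟩
  ext E hE
  have hpu : Measurable fun x ↦ (x, Tu x) := measurable_id.prodMk h.measurable_up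
  have hpd : Measurable fun x ↦ (x, Td x) := measurable_id.prodMk h.measurable_down
  have hone : Measurable (E.indicator (1 : ℝ × ℝ → ℝ≥0∞)) := measurable_one.indicator hE
  have hCu : MeasurableSet[𝓕 0] {ω | (B 0 ω, Tu (B 0 ω)) ∈ E} := (hpu.comp (hBa 0)) hE
  have hCd : MeasurableSet[𝓕 0] {ω | (B 0 ω, Td (B 0 ω)) ∈ E} := (hpd.comp (hBa 0)) hE
  have hsplit : (fun ω ↦ (B 0 ω, stoppedValue B τ ω)) ⁻¹' E =ᵐ[Q]
      (({ω | (B 0 ω, Tu (B 0 ω)) ∈ E} ∩ U) ∪ ({ω | (B 0 ω, Td (B 0 ω)) ∈ E} \ U) : Set Ω) := by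
    filter_upwards [hval, h.ae_mem hB0] with ω hω hS
    apply propext
    change (B 0 ω, stoppedValue B τ ω) ∈ E ↔ ((B 0 ω, Tu (B 0 ω)) ∈ E ∧ ω ∈ U) ∨
      ((B 0 ω, Td (B 0 ω)) ∈ E ∧ ω ∉ U)
    by_cases hωU : ω ∈ U
    · simp [hωU, hωU.1]
    · have hd : stoppedValue B τ ω = Td (B 0 ω) := by
        rcases hω with hω | hω
        · have h1 := h.down_le _ hS
          have h2 := h.le_up _ hS
          have h3 : ¬ Td (B 0 ω) < Tu (B 0 ω) := fun hlt ↦ hωU ⟨hω, hlt⟩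
          linarith
        · exact hω
      simp [hωU, hd]
  rw [Measure.map_apply (hB0m.prodMk hBτ) hE, measure_congr hsplit,
    measure_union (disjoint_sdiff_right.mono_left inter_subset_right)
      ((𝓕.le 0 _ hCd).diff hUm), hup _ hCu, hdown _ hCd, h.plan_eq,
    bind_twoPoint_apply μ h.measurable_down h.measurable_up hE, ← hB0.map_eq,
    lintegral_map _ hB0m, lintegral_add_left, ← lintegral_indicator (𝓕.le 0 _ hCu),
    ← lintegral_indicator (𝓕.le 0 _ hCd)]
  · congr 1
    · refine lintegral_congr fun ω ↦ ?_
      by_cases hω : (B 0 ω, Tu (B 0 ω)) ∈ E <;> simp [indicator, hω]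
    · refine lintegral_congr fun ω ↦ ?_
      by_cases hω : (B 0 ω, Td (B 0 ω)) ∈ E <;> simp [indicator, hω]
  · exact ((hqm.comp hB0m).ennreal_ofReal).mul (hone.comp (hpu.comp hB0m))
  · exact (hqm.ennreal_ofReal.mul (hone.comp hpu)).add
      ((measurable_const.sub hqm).ennreal_ofReal.mul (hone.comp hpd))

end IsMonotonePair

/-! ### Properties of Brownian motion -/

theorem tendsto_gaussianReal_Icc (c : ℝ) :
    Tendsto (fun n : ℕ ↦ gaussianReal 0 (n : ℝ≥0) (Icc (-c) c)) atTop (𝓝 0) := by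
  -- The density is bounded by its peak value, of order `1 / √n`.
  have hbound : ∀ᶠ n : ℕ in atTop, gaussianReal 0 (n : ℝ≥0) (Icc (-c) c) ≤
      ENNReal.ofReal ((√(2 * Real.pi * n))⁻¹) * volume (Icc (-c) c) := by
    filter_upwards [eventually_gt_atTop 0] with n hn
    have hn0 : (n : ℝ≥0) ≠ 0 := by exact_mod_cast hn.ne'
    rw [gaussianReal_apply _ hn0, ← setLIntegral_const]
    refine lintegral_mono fun x ↦ ENNReal.ofReal_le_ofReal ?_
    rw [gaussianPDFReal]
    refine mul_le_of_le_one_right (by positivity) (Real.exp_le_one_iff.2 ?_)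
    exact div_nonpos_of_nonpos_of_nonneg (neg_nonpos.2 (sq_nonneg _)) (by positivity)
  refine tendsto_of_tendsto_of_tendsto_of_le_of_le' tendsto_const_nhds ?_
    (Eventually.of_forall fun _ ↦ zero_le) hbound
  have h1 : Tendsto (fun n : ℕ ↦ (√(2 * Real.pi * n))⁻¹) atTop (𝓝 0) :=
    tendsto_inv_atTop_zero.comp (Real.tendsto_sqrt_atTop.comp
      (tendsto_natCast_atTop_atTop.const_mul_atTop (by positivity)))
  have h2 := ENNReal.Tendsto.mul_const (ENNReal.tendsto_ofReal h1)
    (b := volume (Icc (-c) c)) (.inr (by simp))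
  simpa using h2

namespace IsBrownianFrom

variable {Ω : Type*} {mΩ : MeasurableSpace Ω} {Q : Measure Ω}
  {𝓕 : Filtration ℝ≥0 mΩ} {μ : Measure ℝ} {B : ℝ≥0 → Ω → ℝ}

theorem martingale [IsProbabilityMeasure Q] (h : IsBrownianFrom 𝓕 Q μ B) (hμ : Integrable id μ) :
    Martingale B 𝓕 Q := by
  have hm : ∀ t, Measurable (B t) := fun t ↦ (h.adapted t).mono (𝓕.le t) le_rfl
  have h0 : Integrable (B 0) Q := by
    rw [← h.hasLaw_zero.map_eq] at hμ
    exact hμ.comp_measurable (hm 0)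
  have hint : ∀ t, Integrable (B t) Q := fun t ↦ by
    refine ((h.brownian.integrable_eval t).add h0).congr (ae_of_all _ fun ω ↦ ?_)
    simp
  refine ⟨h.adapted.stronglyAdapted, fun s t hst ↦ ?_⟩
  have hincr : Q[fun ω ↦ B t ω - B s ω | 𝓕 s] =ᵐ[Q] fun _ ↦ 0 := by
    have hcomap : MeasurableSpace.comap (fun ω ↦ B t ω - B s ω) inferInstance ≤ mΩ :=
      ((hm t).sub (hm s)).comap_le
    have hcond := condExp_indep_eq hcomap (𝓕.le s)
      (comap_measurable (fun ω ↦ B t ω - B s ω)).stronglyMeasurable (h.indep s t hst)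
    have hmean : ∀ t, ∫ ω, B t ω ∂Q = ∫ ω, B 0 ω ∂Q := fun t ↦ by
      have := h.brownian.integral_eval t
      rwa [integral_sub (hint t) (hint 0), sub_eq_zero] at this
    rwa [integral_sub (hint t) (hint s), hmean t, hmean s, sub_self] at hcond
  have hsum : B t = (fun ω ↦ B t ω - B s ω) + B s := by funext ω; simp
  have hadd := condExp_add ((hint t).sub (hint s)) (hint s) (𝓕 s)
  have hs : Q[B s | 𝓕 s] = B s :=
    condExp_of_stronglyMeasurable (𝓕.le s) (h.adapted s).stronglyMeasurable (hint s)
  rw [hsum]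
  filter_upwards [hadd, hincr] with ω h1 h2
  refine h1.trans ?_
  have h3 : (Q[B t - B s | 𝓕 s]) ω = 0 := h2
  rw [Pi.add_apply, h3, hs, zero_add]

theorem ae_ne (h : IsBrownianFrom 𝓕 Q μ B) {p r : ℝ≥0} (hpr : p ≠ r) :
    ∀ᵐ ω ∂Q, B p ω ≠ B r ω := by
  have hlaw := h.brownian.hasLaw_sub p r
  have hv : nndist p.1 r.1 ≠ 0 := by
    rw [ne_eq, nndist_eq_zero]; exact fun h ↦ hpr (Subtype.ext h)
  have : ∀ᵐ x ∂(gaussianReal 0 (nndist p.1 r.1)), x ≠ 0 := by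
    have := nullSingletonClass_gaussianReal (μ := 0) hv
    exact measure_eq_zero_iff_ae_notMem.1
      (measure_singleton (μ := gaussianReal 0 (nndist p.1 r.1)) 0)
  rw [← hlaw.map_eq] at this
  filter_upwards [ae_of_ae_map hlaw.aemeasurable this] with ω hω heq
  exact hω (by simp [heq])

theorem tendsto_measure_abs_sub_le (h : IsBrownianFrom 𝓕 Q μ B) (c : ℝ) :
    Tendsto (fun n : ℕ ↦ Q {ω | |B n ω - B 0 ω| ≤ c}) atTop (𝓝 0) := by
  refine (tendsto_gaussianReal_Icc c).congr fun n ↦ ?_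
  have := (h.brownian.hasLaw_eval n).measure_eq (p := fun x ↦ x ∈ Icc (-c) c) measurableSet_Icc
  simp only [mem_Icc, ← abs_le] at this
  rw [this]
  simp only [abs_le]
  rfl

theorem ae_continuous (h : IsBrownianFrom 𝓕 Q μ B) : ∀ᵐ ω ∂Q, Continuous (B · ω) := by
  filter_upwards [h.brownian.cont] with ω hω
  convert hω.add (continuous_const (y := B 0 ω)) using 1
  funext t
  simp

end IsBrownianFrom

/-! ### Null-set modifications and the final assembly -/

namespace UsualConditions

variable {Ω : Type*} {mΩ : MeasurableSpace Ω} {Q : Measure Ω} {𝓕 : Filtration ℝ≥0 mΩ}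

theorem isStoppingTime_congr (h : UsualConditions 𝓕 Q) {σ τ : Ω → WithTop ℝ≥0}
    (hσ : IsStoppingTime 𝓕 σ) (heq : τ =ᵐ[Q] σ) : IsStoppingTime 𝓕 τ := by
  intro t
  have hnull : ∀ A : Set Ω, A ⊆ {ω | τ ω ≠ σ ω} → MeasurableSet[𝓕 t] A := fun A hA ↦
    𝓕.mono zero_le _ (h.complete A (measure_mono_null hA heq))
  have : {ω | τ ω ≤ t} = ({ω | σ ω ≤ t} \ {ω | τ ω ≠ σ ω}) ∪
      ({ω | τ ω ≤ t} ∩ {ω | τ ω ≠ σ ω}) := by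
    ext ω
    by_cases hω : τ ω = σ ω <;> simp [hω]
  rw [this]
  exact ((hσ t).diff (hnull _ subset_rfl)).union (hnull _ inter_subset_right)

/-- A martingale with almost surely continuous paths has a modification on a null set with
continuous paths. -/
theorem exists_continuous_martingale (h : UsualConditions 𝓕 Q) {B : ℝ≥0 → Ω → ℝ}
    (hB : Martingale B 𝓕 Q) (hc : ∀ᵐ ω ∂Q, Continuous (B · ω)) :
    ∃ B' : ℝ≥0 → Ω → ℝ, Martingale B' 𝓕 Q ∧ (∀ ω, Continuous (B' · ω)) ∧
      ∀ᵐ ω ∂Q, ∀ t, B' t ω = B t ω := by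
  classical
  set G : Set Ω := {ω | Continuous (B · ω)} with hG
  have hGm : MeasurableSet[𝓕 0] G := by
    rw [← compl_compl G]
    exact (h.complete _ hc).compl
  have heq : ∀ᵐ ω ∂Q, ∀ t, G.indicator (B t) ω = B t ω := by
    filter_upwards [hc] with ω hω t
    exact indicator_of_mem (show ω ∈ G from hω) _
  have heqt : ∀ t, G.indicator (B t) =ᵐ[Q] B t := fun t ↦ heq.mono fun ω hω ↦ hω t
  refine ⟨fun t ↦ G.indicator (B t), ⟨fun t ↦ ?_, fun s t hst ↦ ?_⟩, fun ω ↦ ?_, heq⟩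
  · exact (hB.stronglyAdapted t).indicator (𝓕.mono zero_le _ hGm)
  · exact (condExp_congr_ae (heqt t)).trans ((hB.condExp_ae_eq hst).trans (heqt s).symm)
  · by_cases hω : ω ∈ G
    · have hcω : Continuous (B · ω) := hω
      simpa only [indicator_of_mem hω] using hcω
    · simpa only [indicator_of_notMem hω] using continuous_const

end UsualConditions

theorem mainTheorem4 (μ ν : Measure ℝ) [IsProbabilityMeasure μ] [IsProbabilityMeasure ν]
    (hatom : ∀ x : ℝ, μ {x} = 0) (hμ : Integrable id μ) (hν : Integrable id ν)
    (P : Measure (ℝ × ℝ)) (hP : IsMartingalePlan μ ν P) (hmono : IsLeftMonotone P) :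
    (∃ (S : Set ℝ) (Td Tu : ℝ → ℝ), IsMonotonePair μ P S Td Tu) ∧
    ∀ (S : Set ℝ) (Td Tu : ℝ → ℝ), IsMonotonePair μ P S Td Tu →
      IsBarrier (monotoneBarrier S Td Tu) ∧
      ∀ (Ω : Type*) (mΩ : MeasurableSpace Ω) (Q : Measure Ω) (_ : IsProbabilityMeasure Q)
        (𝓕 : Filtration ℝ≥0 mΩ) (B : ℝ≥0 → Ω → ℝ),
        UsualConditions 𝓕 Q → IsBrownianFrom 𝓕 Q μ B →
          IsStoppingTime 𝓕 (barrierTime B (monotoneBarrier S Td Tu)) ∧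
          IsStoppingTime 𝓕 (planExitTime B Td Tu) ∧
          barrierTime B (monotoneBarrier S Td Tu) =ᵐ[Q] planExitTime B Td Tu ∧
          IsMinimalEmbedding 𝓕 Q B ν (barrierTime B (monotoneBarrier S Td Tu)) ∧
          HasLaw (fun ω ↦
            (B 0 ω, stoppedValue B (barrierTime B (monotoneBarrier S Td Tu)) ω)) P Q := by
  refine ⟨hP.exists_isMonotonePair hatom hν hmono, fun S Td Tu h ↦ ⟨h.isBarrier, ?_⟩⟩
  intro Ω mΩ Q _ 𝓕 B husual hBM
  have := husual.rightContinuous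
  -- The paths of `B` are continuous only almost surely; the argument is run for `B'`, and
  -- completeness of `𝓕 0` carries stopping times back to `B`.
  obtain ⟨B', hB', hc, hBB'⟩ :=
    husual.exists_continuous_martingale (hBM.martingale hμ) hBM.ae_continuous
  have hBa : Adapted 𝓕 B' := hB'.stronglyAdapted.adapted
  have hB0 : HasLaw (B' 0) μ Q := hBM.hasLaw_zero.congr (hBB'.mono fun ω hω ↦ hω 0)
  have hinc : ∀ p r : ℝ≥0, p ≠ r → ∀ᵐ ω ∂Q, B' p ω ≠ B' r ω := fun p r hpr ↦ by
    filter_upwards [hBM.ae_ne hpr, hBB'] with ω h1 h2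
    rwa [h2, h2]
  have hspread : ∀ c : ℝ, Tendsto (fun n : ℕ ↦ Q {ω | |B' n ω - B' 0 ω| ≤ c}) atTop (𝓝 0) := by
    refine fun c ↦ (hBM.tendsto_measure_abs_sub_le c).congr fun n ↦ measure_congr ?_
    filter_upwards [hBB'] with ω hω
    apply propext
    change |B n ω - B 0 ω| ≤ c ↔ |B' n ω - B' 0 ω| ≤ c
    rw [hω, hω]
  have hfin := h.planExitTime_ne_top hc hB0 hspread
  set σ := boundaryTime B' Td Tu with hσdef
  have hσ : IsStoppingTime 𝓕 σ := h.isStoppingTime_boundaryTime hBa hc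
  have hσle : σ ≤ planExitTime B' Td Tu := IsMonotonePair.boundaryTime_le_planExitTime
  have hσfin : ∀ᵐ ω ∂Q, σ ω ≠ ⊤ := hfin.mono fun ω hω ↦ ne_top_of_le_ne_top hω (hσle ω)
  have hexit : σ =ᵐ[Q] planExitTime B' Td Tu :=
    h.boundaryTime_ae_eq_planExitTime hB' hc hB0 hinc hfin
  have hplan : planExitTime B Td Tu =ᵐ[Q] planExitTime B' Td Tu := by
    filter_upwards [hBB'] with ω hω
    simp only [planExitTime, hω]
  have hbar : barrierTime B (monotoneBarrier S Td Tu) =ᵐ[Q] σ := by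
    filter_upwards [hBB', h.ae_mem hB0] with ω hω hS
    rw [hσdef, ← h.barrierTime_eq_boundaryTime hS (hc ω)]
    classical exact if_congr (by simp only [hω]) (by simp only [hω]) rfl
  have hsval : ∀ ρ ρ' : Ω → WithTop ℝ≥0, ρ =ᵐ[Q] ρ' →
      stoppedValue B ρ =ᵐ[Q] stoppedValue B' ρ' := by
    intro ρ ρ' heq
    filter_upwards [heq, hBB'] with ω h1 h2
    rw [stoppedValue, stoppedValue, h1, h2]
  have hval : ∀ᵐ ω ∂Q, stoppedValue B' σ ω = Tu (B' 0 ω) ∨ stoppedValue B' σ ω = Td (B' 0 ω) := by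
    filter_upwards [hσfin, h.ae_mem hB0] with ω hω hS
    exact h.stoppedValue_boundaryTime hS (hc ω) hω
  have hlaw' : HasLaw (fun ω ↦ (B' 0 ω, stoppedValue B' σ ω)) P Q :=
    h.hasLaw_stoppedValue hB' hc hB0 hσ hσle hσfin hval
  have hlaw : HasLaw (fun ω ↦
      (B 0 ω, stoppedValue B (barrierTime B (monotoneBarrier S Td Tu)) ω)) P Q := by
    refine hlaw'.congr ?_
    filter_upwards [hBB', hsval _ _ hbar] with ω h1 h2
    rw [h1, h2]
  have hsnd : HasLaw (Prod.snd : ℝ × ℝ → ℝ) ν P := ⟨measurable_snd.aemeasurable, hP.map_snd⟩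
  have hνσ : HasLaw (stoppedValue B' σ) ν Q := hsnd.comp hlaw'
  refine ⟨husual.isStoppingTime_congr hσ hbar,
    husual.isStoppingTime_congr (h.isStoppingTime_planExitTime hBa hc) hplan,
    hbar.trans (hexit.trans hplan.symm),
    ⟨husual.isStoppingTime_congr hσ hbar, ?_, hsnd.comp hlaw, ?_⟩, hlaw⟩
  · filter_upwards [hbar, hσfin] with ω h1 h2
    rwa [h1]
  · intro ρ hρ hρle hρlaw
    -- The minimum turns the almost sure inequality into one valid everywhere, as the comparison
    -- lemmas require.
    have hmin : (fun ω ↦ min (ρ ω) (σ ω)) =ᵐ[Q] ρ := by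
      filter_upwards [hρle, hbar] with ω h1 h2
      exact min_eq_left (h2 ▸ h1)
    have hρσ : HasLaw (stoppedValue B' fun ω ↦ min (ρ ω) (σ ω)) ν Q :=
      hρlaw.congr (hsval _ _ hmin.symm).symm
    have hint : Integrable (stoppedValue B' σ) Q := by
      rw [← hνσ.map_eq] at hν
      exact hν.comp_aemeasurable hνσ.aemeasurable
    have heq : (fun ω ↦ min (ρ ω) (σ ω)) =ᵐ[Q] σ := by
      refine ae_eq_of_forall_stoppedValue_ae_eq hinc (hρ.min hσ) hσ (fun ω ↦ min_le_right _ _)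
        fun π hπ h1 h2 ↦ ?_
      exact hB'.stoppedValue_ae_eq_of_map_eq hc (hρ.min hσ) hσ (fun ω ↦ min_le_right _ _) hσfin
        (h.measurableSet_boundedEvent hBa) IsMonotonePair.monotone_boundedEvent
        ((h.ae_mem hB0).mono fun ω hω ↦ IsMonotonePair.exists_mem_boundedEvent hω)
        (fun n ω hω t ht ↦ h.abs_le_of_mem_boundedEvent hc hω (ht.trans (hσle ω)))
        hint (hρσ.map_eq.trans hνσ.map_eq.symm) hπ h1 h2
    exact hmin.symm.trans (heq.trans hbar.symm)
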